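/- \textbf{Theorem (Prediction Rule).} Let $\Omega$ be a measurable space whose points are separated by countably many measurable sets, let $G_0$ be a finite measure on $\Omega$ giving mass zero to every point, let $\gamma_0=G_0(\Omega)$, and let $\rho$ be a measure on $\mathbb{R}_+=[0,\infty)$ with $\iint_{\mathbb{R}_+\times\Omega}\min\{1,r\}\,\rho(dr)G_0(d\omega)<\infty$. Consider the count-mixture model with scale parameter $1$: (i) $G=\sum_{k=1}^{K}r_k\delta_{\omega_k}$, $K\le\infty$, with distinct random atoms $\omega_k\in\Omega$ of weights $r_k>0$, is a random measure with $G(\Omega)<\infty$ a.s., such that $G(A_1),\dots,G(A_N)$ are independent for pairwise disjoint measurable $A_1,\dots,A_N$ and, for every measurable $A\subset\Omega$ and $u\in\mathbb{R}$, $$\mathbb{E}\big[e^{iuG(A)}\big]=\exp\Big\{\iint_{\mathbb{R}_+\times A}(e^{iur}-1)\,\rho(dr)G_0(d\omega)\Big\},$$ i.e. $G$ is a homogeneous completely random measure with Lévy measure $\rho(dr)G_0(d\omega)$; (ii) given the atoms and weights, $m\sim\mathrm{Pois}(G(\Omega))$ and, given also $m$, the labels $z_1,\dots,z_m$ are i.i.d.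 with law $\sum_{k=1}^K\frac{r_k}{G(\Omega)}\delta_k$ (if $G(\Omega)=0$ then $m=0$). Two data points are in the same cluster if and only if their labels agree. Fix a sample size $m\ge 1$ and an index $i\in\{1,\dots,m\}$. Let $\boldsymbol z^{-i}$ denote the labels of the other $m-1$ data points, relabelled $1,2,\dots,l^{-i}$ in order of appearance among these points, where $l^{-i}$ is the number of their clusters, and let $n_k^{-i}\ge 1$ be the number of points $j\ne i$ in cluster $k$. Write $z_i=k\le l^{-i}$ if point $i$ belongs to cluster $k$, and $z_i=l^{-i}+1$ if it shares its cluster with no other point. Put $$w_k=\begin{cases}\dfrac{\int_0^\infty r^{\,n_k^{-i}+1}e^{-r}\rho(dr)}{\int_0^\infty r^{\,n_k^{-i}}e^{-r}\rho(dr)}, & k=1,\dots,l^{-i},\\[3mm] \gamma_0\displaystyle\int_0^\infty re^{-r}\rho(dr), & k=l^{-i}+1.\end{cases}$$ Then for every value of $\boldsymbol z^{-i}$ that has positive probability jointly with the sample size $m$, all $w_k$ are positive and finite, and $$P(z_i=k\mid\boldsymbol z^{-i},m,\gamma_0,\rho)=\frac{w_k}{\sum_{k'=1}^{l^{-i}+1}w_{k'}},\qquad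 k=1,\dots,l^{-i}+1,$$ that is, $P(z_i=k\mid\boldsymbol z^{-i},m,\gamma_0,\rho)\propto w_k$. -/

import Mathlib

open MeasureTheory ProbabilityTheory
open scoped NNReal ENNReal

namespace CountMixture

variable {S Ω : Type*} [MeasurableSpace S] [MeasurableSpace Ω]

/-- `G` is a completely random measure on `Ω`, over the probability space `(S, P)`, with Lévy
measure `ν` on `ℝ₊ × Ω`: `∫∫ min(1, r) ν(dr dω) < ∞`, `G` is a.s. finite, the masses of pairwise
disjoint measurable sets are independent, and
`E[exp(i u G(A))] = exp(∫∫_{ℝ₊ × A} (exp(i u r) - 1) ν(dr dω))`. -/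
structure IsCompletelyRandomMeasure (ν : Measure (ℝ≥0 × Ω)) (P : Measure S)
    (G : S → Measure Ω) : Prop where
  measurable : Measurable G
  finite : ∀ᵐ s ∂P, G s Set.univ < ∞
  levy : ∫⁻ p, ((min 1 p.1 : ℝ≥0) : ℝ≥0∞) ∂ν < ∞
  indep : ∀ (N : ℕ) (A : Fin N → Set Ω), (∀ j, MeasurableSet (A j)) →
    Pairwise (fun i j => Disjoint (A i) (A j)) → iIndepFun (fun j s => G s (A j)) P
  charFun : ∀ A : Set Ω, MeasurableSet A → ∀ u : ℝ,
    ∫ s, Complex.exp (Complex.I * u * ((G s A).toReal : ℂ)) ∂P =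
      Complex.exp (∫ p in Set.univ ×ˢ A, (Complex.exp (Complex.I * u * ((p.1 : ℝ) : ℂ)) - 1) ∂ν)

/-- The random discrete measure `G = ∑ₖ rₖ δ_{ωₖ}` with weights `r k` and atoms `loc k`.  Finitely
many atoms are covered by letting all but finitely many weights vanish. -/
noncomputable def atomicMeasure (r : ℕ → S → ℝ≥0) (loc : ℕ → S → Ω) (s : S) : Measure Ω :=
  Measure.sum fun k => (r k s : ℝ≥0∞) • Measure.dirac (loc k s)

/-- The total random mass `G(Ω)`. -/
noncomputable def totalMass (r : ℕ → S → ℝ≥0) (loc : ℕ → S → Ω) (s : S) : ℝ≥0 :=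
  (atomicMeasure r loc s Set.univ).toNNReal

/-- The sigma-algebra generated by all weights and atoms of `G`. -/
abbrev atomSigma (r : ℕ → S → ℝ≥0) (loc : ℕ → S → Ω) : MeasurableSpace S :=
  MeasurableSpace.comap (fun s k => (r k s, loc k s)) inferInstance

/-- The count-mixture model (with scale parameter `β = 1`).
`G = ∑ₖ rₖ δ_{ωₖ}`, with distinct atoms, is a homogeneous completely random measure with Lévy
measure `ρ(dr) G₀(dω)`; given `G`, the sample size `m` is `Pois(G(Ω))` distributed and, given `G`
and `m`, the labels `z 0, …, z (m - 1)` of the `m` data points are independent with law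
`∑ₖ (rₖ / G(Ω)) δₖ`.  The entries `z i` with `i ≥ m` play no role. -/
structure IsCountMixture (ρ : Measure ℝ≥0) (G₀ : Measure Ω) (P : Measure S)
    (r : ℕ → S → ℝ≥0) (loc : ℕ → S → Ω) (m : S → ℕ) (z : ℕ → S → ℕ) : Prop where
  measurable_weight : ∀ k, Measurable (r k)
  measurable_loc : ∀ k, Measurable (loc k)
  measurable_size : Measurable m
  measurable_label : ∀ i, Measurable (z i)
  distinct : ∀ᵐ s ∂P, ∀ j k, 0 < r j s → 0 < r k s → loc j s = loc k s → j = k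
  crm : IsCompletelyRandomMeasure (ρ.prod G₀) P (atomicMeasure r loc)
  condLaw : ∀ (n : ℕ) (c : Fin n → ℕ),
    P⟦{s | m s = n ∧ ∀ i : Fin n, z i s = c i} | atomSigma r loc⟧ =ᵐ[P]
      fun s => (poissonMeasure (totalMass r loc s)).real {n} *
        ∏ i, (r (c i) s : ℝ) / (totalMass r loc s : ℝ)

/-- Relabelling of a label vector in order of appearance, starting from `1`: the new label of
position `i` is the number of distinct values of `c` up to the first occurrence of `c i`. -/
def appearanceLabel {n : ℕ} (c : Fin n → ℕ) (i : Fin n) : ℕ :=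
  ((Finset.univ.filter fun j => ∀ i', c i' = c i → j ≤ i').image c).card

/-- `z^{-i}`: the labels of the elements other than `i`, clusters being numbered `1, 2, …` in order
of appearance among these elements. -/
def labelsWithout {n : ℕ} (i : Fin (n + 1)) (c : Fin (n + 1) → ℕ) : Fin n → ℕ :=
  appearanceLabel (i.removeNth c)

/-- The label of element `i` relative to `labelsWithout i c`: it is `k` if `i` belongs to the
cluster numbered `k` there, and one more than the number of clusters there if `i` shares its
cluster with no other element.  (Relabelling by appearance with `i` visited last.) -/
def labelOf {n : ℕ} (i : Fin (n + 1)) (c : Fin (n + 1) → ℕ) : ℕ :=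
  appearanceLabel (Fin.snoc (α := fun _ => ℕ) (i.removeNth c) (c i)) (Fin.last n)

/-- The number of clusters in a label vector. -/
def numClusters {n : ℕ} (y : Fin n → ℕ) : ℕ := (Finset.univ.image y).card

/-- The size of cluster `k` in a label vector. -/
def clusterSize {n : ℕ} (y : Fin n → ℕ) (k : ℕ) : ℕ := (Finset.univ.filter fun j => y j = k).card

/-- `∫ r^n e^{-r} ρ(dr)`. -/
noncomputable def tiltedMoment (ρ : Measure ℝ≥0) (n : ℕ) : ℝ :=
  ∫ r, (r : ℝ) ^ n * Real.exp (-(r : ℝ)) ∂ρ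

/-- The unnormalised weight of label `k` in the prediction rule, given the labels `y` of the other
elements: an existing cluster if `k ≤ numClusters y`, a new cluster otherwise. -/
noncomputable def predictionWeight (γ₀ : ℝ) (ρ : Measure ℝ≥0) {n : ℕ} (y : Fin n → ℕ) (k : ℕ) :
    ℝ :=
  if k ≤ numClusters y then
    tiltedMoment ρ (clusterSize y k + 1) / tiltedMoment ρ (clusterSize y k)
  else γ₀ * tiltedMoment ρ 1

end CountMixture

/-! Write κ(j) = ∫ r^j e^{-r} ρ(dr). Up to a factor that does not depend on the partition, the
probability of sample size n + 1 jointly with a given partition is the product of γ₀ κ(size) over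
its clusters (`IsCountMixture.exists_measure_samePattern_eq`). Adding a point to a cluster of size j
turns κ(j) into κ(j + 1), and opening a cluster contributes γ₀ κ(1); normalising these ratios gives
the prediction rule.

For the product formula, let T = G(Ω). The Poisson weight e^{-T} T^{n+1}/(n+1)! cancels the
denominators T of the label law, leaving the expectation of e^{-T} ∏ r_{c i} summed over label
vectors c with the given pattern (`measure_labels_eq`). Equality of labels is then approximated by
equality of the cells containing the atoms, in ever finer finite partitions of Ω
(`tendsto_lintegral_cell`). For a fixed partition the cell masses are independent, so the
expectation factors into terms E[G(A)^j e^{-G(A)}] (`integral_exp_mul_prod`).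

To compute these, the Lévy–Khintchine formula is extended from the imaginary axis to the right
half-plane by Phragmén–Lindelöf and differentiated repeatedly (`complexMoment_succ_eq`). At z = 1
each term is a complete Bell polynomial in the numbers G₀(A) κ(·), times an exponential; the
exponentials multiply to a common constant. The Bell polynomial of order j ≥ 1 is G₀(A) κ(j) +
O(G₀(A)²). Since G₀ has no atoms, the sum of G₀(A)² over cells tends to zero
(`tendsto_sum_sq_cell`), so only the linear terms survive, and cases where two clusters share a cell
disappear (`tendsto_sum_injective_prod`). -/

namespace CountMixture

/-! ### Laplace exponents and tilted moments on the right half-plane -/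

/-- The Laplace exponent `∫ (e^{-zr} - 1) μ(dr)`. -/
noncomputable def laplaceExponent (μ : Measure ℝ≥0) (z : ℂ) : ℂ :=
  ∫ r, (Complex.exp (-(z * ((r : ℝ) : ℂ))) - 1) ∂μ

/-- The exponentially tilted moment `∫ r^n e^{-zr} μ(dr)` with complex tilting parameter. -/
noncomputable def complexMoment (μ : Measure ℝ≥0) (n : ℕ) (z : ℂ) : ℂ :=
  ∫ r, ((r : ℝ) : ℂ) ^ n * Complex.exp (-(z * ((r : ℝ) : ℂ))) ∂μ

lemma pow_mul_exp_neg_le (n : ℕ) {ε : ℝ} (hε : 0 < ε) {x : ℝ} (hx : 0 ≤ x) :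
    x ^ n * Real.exp (-(ε * x)) ≤ n.factorial / ε ^ n := by
  have h := Real.pow_div_factorial_le_exp (ε * x) (by positivity) n
  rw [Real.exp_neg, mul_inv_le_iff₀ (Real.exp_pos _), div_mul_eq_mul_div, le_div_iff₀ (by positivity)]
  rw [div_le_iff₀ (by positivity), mul_pow] at h
  linarith

/-- A Lévy measure may be infinite near zero and integrates only `min 1 r`; one power of `x` is
spent there, which is why the exponent is `n + 1`. -/
lemma exists_pow_succ_mul_exp_neg_le (n : ℕ) {ε : ℝ} (hε : 0 < ε) :
    ∃ C : ℝ, ∀ x : ℝ, 0 ≤ x → x ^ (n + 1) * Real.exp (-(ε * x)) ≤ C * min 1 x := by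
  refine ⟨max ((n + 1).factorial / ε ^ (n + 1)) (n.factorial / ε ^ n), fun x hx => ?_⟩
  rcases le_total 1 x with h | h
  · rw [min_eq_left h, mul_one]
    exact (pow_mul_exp_neg_le (n + 1) hε hx).trans (le_max_left _ _)
  · rw [min_eq_right h]
    calc x ^ (n + 1) * Real.exp (-(ε * x)) = (x ^ n * Real.exp (-(ε * x))) * x := by ring
      _ ≤ (n.factorial / ε ^ n) * x := by gcongr; exact pow_mul_exp_neg_le n hε hx
      _ ≤ _ := by gcongr; exact le_max_right _ _

lemma norm_exp_neg_mul_ofReal (z : ℂ) (x : ℝ) :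
    ‖Complex.exp (-(z * (x : ℂ)))‖ = Real.exp (-(z.re * x)) := by
  simp [Complex.norm_exp]

lemma norm_exp_neg_sub_one_le {z : ℂ} (hz : 0 ≤ z.re) {x : ℝ} (hx : 0 ≤ x) :
    ‖Complex.exp (-(z * (x : ℂ))) - 1‖ ≤ 2 * (1 + ‖z‖) * min 1 x := by
  have h1 : ‖Complex.exp (-(z * (x : ℂ))) - 1‖ ≤ 2 := by
    refine (norm_sub_le _ _).trans ?_
    rw [norm_exp_neg_mul_ofReal, norm_one]
    have : Real.exp (-(z.re * x)) ≤ 1 := Real.exp_le_one_iff.2 (by nlinarith)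
    linarith
  rcases le_total 1 x with h | h
  · rw [min_eq_left h]
    nlinarith [norm_nonneg z]
  · rw [min_eq_right h]
    rcases le_total 1 (‖z‖ * x) with h' | h'
    · nlinarith
    · have := Complex.norm_exp_sub_one_le (x := -(z * (x : ℂ)))
        (by simpa [abs_of_nonneg hx] using h')
      rw [norm_neg, norm_mul, Complex.norm_real, Real.norm_of_nonneg hx] at this
      nlinarith

variable {μ : Measure ℝ≥0}

lemma integrable_pow_mul_exp (hμ : Integrable (fun r : ℝ≥0 => min 1 (r : ℝ)) μ) (n : ℕ)
    {ε : ℝ} (hε : 0 < ε) :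
    Integrable (fun r : ℝ≥0 => (r : ℝ) ^ (n + 1) * Real.exp (-(ε * r))) μ := by
  obtain ⟨C, hC⟩ := exists_pow_succ_mul_exp_neg_le n hε
  refine (hμ.const_mul C).mono' (by fun_prop) (ae_of_all _ fun r => ?_)
  rw [Real.norm_of_nonneg (by positivity)]
  exact hC r r.2

lemma integrable_exp_neg_sub_one (hμ : Integrable (fun r : ℝ≥0 => min 1 (r : ℝ)) μ) {z : ℂ}
    (hz : 0 ≤ z.re) :
    Integrable (fun r : ℝ≥0 => Complex.exp (-(z * ((r : ℝ) : ℂ))) - 1) μ := by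
  refine (hμ.const_mul (2 * (1 + ‖z‖))).mono' (by fun_prop) (ae_of_all _ fun r => ?_)
  exact norm_exp_neg_sub_one_le hz r.2

lemma norm_pow_mul_exp_le {z w : ℂ} (hw : w ∈ Metric.ball z (z.re / 2)) (n : ℕ) (r : ℝ≥0) :
    ‖((r : ℝ) : ℂ) ^ n * Complex.exp (-(w * ((r : ℝ) : ℂ)))‖ ≤
      (r : ℝ) ^ n * Real.exp (-(z.re / 2 * r)) := by
  rw [norm_mul, norm_pow, Complex.norm_real, Real.norm_of_nonneg r.coe_nonneg, norm_exp_neg_mul_ofReal]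
  have h1 := (Complex.abs_re_le_norm (w - z)).trans_lt (mem_ball_iff_norm.1 hw)
  rw [Complex.sub_re, abs_lt] at h1
  have : z.re / 2 ≤ w.re := by linarith
  have hr := r.2
  gcongr

/-- Differentiation under the integral: on the ball of radius `z.re / 2` real parts stay above `z.re
/ 2`, so one tilted moment dominates all derivatives. -/
lemma hasDerivAt_laplaceExponent (hμ : Integrable (fun r : ℝ≥0 => min 1 (r : ℝ)) μ) {z : ℂ}
    (hz : 0 < z.re) : HasDerivAt (laplaceExponent μ) (-complexMoment μ 1 z) z := by
  have := (hasDerivAt_integral_of_dominated_loc_of_deriv_le (μ := μ) (x₀ := z)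
    (s := Metric.ball z (z.re / 2))
    (F := fun z (r : ℝ≥0) => Complex.exp (-(z * ((r : ℝ) : ℂ))) - 1)
    (F' := fun z (r : ℝ≥0) => -(((r : ℝ) : ℂ) ^ 1 * Complex.exp (-(z * ((r : ℝ) : ℂ)))))
    (bound := fun r : ℝ≥0 => (r : ℝ) ^ 1 * Real.exp (-(z.re / 2 * r)))
    (Metric.ball_mem_nhds z (by positivity)) (.of_forall fun w => by fun_prop)
    (integrable_exp_neg_sub_one hμ hz.le) (by fun_prop)
    (ae_of_all _ fun r w hw => by rw [norm_neg]; exact norm_pow_mul_exp_le hw 1 r)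
    (integrable_pow_mul_exp hμ 0 (by positivity))
    (ae_of_all _ fun r w hw => by
      have := (((hasDerivAt_id w).mul_const ((r : ℝ) : ℂ)).neg.cexp).sub_const 1
      convert! this using 1
      simp; ring)).2
  rw [integral_neg] at this
  exact this

lemma hasDerivAt_complexMoment_succ (hμ : Integrable (fun r : ℝ≥0 => min 1 (r : ℝ)) μ) (n : ℕ)
    {z : ℂ} (hz : 0 < z.re) :
    HasDerivAt (complexMoment μ (n + 1)) (-complexMoment μ (n + 2) z) z := by
  have := (hasDerivAt_integral_of_dominated_loc_of_deriv_le (μ := μ) (x₀ := z)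
    (s := Metric.ball z (z.re / 2))
    (F := fun z (r : ℝ≥0) => ((r : ℝ) : ℂ) ^ (n + 1) * Complex.exp (-(z * ((r : ℝ) : ℂ))))
    (F' := fun z (r : ℝ≥0) => -(((r : ℝ) : ℂ) ^ (n + 2) * Complex.exp (-(z * ((r : ℝ) : ℂ)))))
    (bound := fun r : ℝ≥0 => (r : ℝ) ^ (n + 2) * Real.exp (-(z.re / 2 * r)))
    (Metric.ball_mem_nhds z (by positivity)) (.of_forall fun w => by fun_prop)
    ((integrable_pow_mul_exp hμ n (ε := z.re / 2) (by positivity)).mono' (by fun_prop)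
      (ae_of_all _ fun r => norm_pow_mul_exp_le (Metric.mem_ball_self (by positivity)) _ r))
    (by fun_prop)
    (ae_of_all _ fun r w hw => by rw [norm_neg]; exact norm_pow_mul_exp_le hw _ r)
    (integrable_pow_mul_exp hμ (n + 1) (by positivity))
    (ae_of_all _ fun r w hw => by
      have := (((hasDerivAt_id w).mul_const ((r : ℝ) : ℂ)).neg.cexp).const_mul
        (((r : ℝ) : ℂ) ^ (n + 1))
      convert! this using 1
      simp; ring)).2
  rw [integral_neg] at this
  exact this

/-- Continuity up to the imaginary axis matters because the characteristic function lives there. -/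
lemma diffContOnCl_laplaceExponent (hμ : Integrable (fun r : ℝ≥0 => min 1 (r : ℝ)) μ) :
    DiffContOnCl ℂ (laplaceExponent μ) {z | 0 < z.re} := by
  refine ⟨fun z hz =>
    (hasDerivAt_laplaceExponent hμ hz).differentiableAt.differentiableWithinAt, ?_⟩
  rw [Complex.closure_setOfPred_lt_re]
  intro z hz
  refine tendsto_integral_filter_of_dominated_convergence
    (fun r : ℝ≥0 => 2 * (1 + (‖z‖ + 1)) * min 1 (r : ℝ)) (.of_forall fun w => by fun_prop) ?_
    (hμ.const_mul _) (ae_of_all _ fun r => ?_)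
  · filter_upwards [self_mem_nhdsWithin, nhdsWithin_le_nhds (Metric.ball_mem_nhds z one_pos)]
      with w hw hw'
    refine ae_of_all _ fun r => (norm_exp_neg_sub_one_le hw r.2).trans ?_
    have : ‖w‖ ≤ ‖z‖ + 1 := by
      have := norm_le_norm_add_norm_sub' w z
      have := mem_ball_iff_norm.1 hw'
      linarith
    exact mul_le_mul_of_nonneg_right (by linarith) (le_min zero_le_one r.coe_nonneg)
  · exact Continuous.continuousWithinAt (f := fun w : ℂ => Complex.exp (-(w * ((r : ℝ) : ℂ))) - 1)
      (by fun_prop)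

lemma integrable_min_one_of_isFiniteMeasure [IsFiniteMeasure μ] :
    Integrable (fun r : ℝ≥0 => min 1 (r : ℝ)) μ := by
  refine (integrable_const (1 : ℝ)).mono' (by fun_prop) (ae_of_all _ fun r => ?_)
  rw [Real.norm_of_nonneg (le_min zero_le_one r.coe_nonneg)]
  exact min_le_left _ _

lemma complexMoment_zero_eq [IsProbabilityMeasure μ] {z : ℂ} (hz : 0 ≤ z.re) :
    complexMoment μ 0 z = laplaceExponent μ z + 1 := by
  have hi := integrable_exp_neg_sub_one (integrable_min_one_of_isFiniteMeasure (μ := μ)) hz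
  calc complexMoment μ 0 z
      = ∫ r : ℝ≥0, ((Complex.exp (-(z * ((r : ℝ) : ℂ))) - 1) + 1) ∂μ := by simp [complexMoment]
    _ = _ := by rw [integral_add hi (integrable_const _)]; simp [laplaceExponent]

lemma re_laplaceExponent_nonpos (hμ : Integrable (fun r : ℝ≥0 => min 1 (r : ℝ)) μ) {z : ℂ}
    (hz : 0 ≤ z.re) : (laplaceExponent μ z).re ≤ 0 := by
  have hi := integrable_exp_neg_sub_one hμ hz
  have : (laplaceExponent μ z).re = _ := (integral_re hi).symm
  rw [this]
  refine integral_nonpos fun r => ?_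
  have h1 := Complex.re_le_norm (Complex.exp (-(z * ((r : ℝ) : ℂ))))
  rw [norm_exp_neg_mul_ofReal] at h1
  have h2 : Real.exp (-(z.re * r)) ≤ 1 :=
    Real.exp_le_one_iff.2 (by have := mul_nonneg hz r.2; linarith!)
  simp only [Pi.zero_apply, RCLike.re_to_complex, Complex.sub_re, Complex.one_re]
  linarith

/-- A Lévy–Khintchine formula for the characteristic function of a law on `[0, ∞)` extends to the
Laplace transform on the right half-plane. -/
lemma complexMoment_zero_eq_exp {ν : Measure ℝ≥0} [IsProbabilityMeasure μ]
    (hν : Integrable (fun r : ℝ≥0 => min 1 (r : ℝ)) ν) {c : ℝ} (hc : 0 ≤ c)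
    (h : ∀ u : ℝ, complexMoment μ 0 (u * Complex.I) =
      Complex.exp (c * laplaceExponent ν (u * Complex.I)))
    {z : ℂ} (hz : 0 ≤ z.re) :
    complexMoment μ 0 z = Complex.exp (c * laplaceExponent ν z) := by
  have hμ := integrable_min_one_of_isFiniteMeasure (μ := μ)
  set f : ℂ → ℂ := fun z => laplaceExponent μ z + 1 - Complex.exp (c * laplaceExponent ν z)
  have hbd : ∀ z : ℂ, 0 ≤ z.re → ‖f z‖ ≤ 2 := by
    intro z hz
    have h1 : ‖laplaceExponent μ z + 1‖ ≤ 1 := by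
      rw [← complexMoment_zero_eq hz]
      refine (norm_integral_le_of_norm_le_const (C := 1) (ae_of_all _ fun r => ?_)).trans
        (by simp)
      rw [pow_zero, one_mul, norm_exp_neg_mul_ofReal, Real.exp_le_one_iff]
      have := mul_nonneg hz r.2
      linarith!
    have h2 : ‖Complex.exp (c * laplaceExponent ν z)‖ ≤ 1 := by
      rw [Complex.norm_exp, Complex.re_ofReal_mul, Real.exp_le_one_iff]
      exact mul_nonpos_of_nonneg_of_nonpos hc (re_laplaceExponent_nonpos hν hz)
    exact (norm_sub_le _ _).trans (by linarith)
  have hf : DiffContOnCl ℂ f {z | 0 < z.re} := by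
    refine ((diffContOnCl_laplaceExponent hμ).add_const 1).sub ?_
    exact Complex.differentiable_exp.comp_diffContOnCl
      ((diffContOnCl_laplaceExponent hν).const_smul (c : ℂ))
  -- The difference `f` of the two sides is bounded by 2 on the closed half-plane and vanishes on
  -- the imaginary axis, hence `C = 0`; boundedness covers the growth condition with exponent 1 and
  -- coefficient 0.
  have := PhragmenLindelof.right_half_plane_of_bounded_on_real (C := 0) hf
    ⟨1, by norm_num, 0, ?_⟩ ?_ ?_ hz
  · rw [complexMoment_zero_eq hz]
    exact sub_eq_zero.1 (norm_le_zero_iff.1 this)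
  · refine Asymptotics.IsBigO.of_bound 2 ?_
    filter_upwards [Filter.mem_inf_of_right (Filter.mem_principal_self _)] with z hz
    simpa using hbd z (le_of_lt hz)
  · refine Filter.isBoundedUnder_of_eventually_le (a := 2) ?_
    filter_upwards [Filter.eventually_ge_atTop 0] with x hx
    exact hbd x (by simpa using hx)
  · intro x
    simp only [f]
    rw [← complexMoment_zero_eq (by simp), h, sub_self, norm_zero]

/-- The moments of a tilted infinitely divisible law satisfy the recursion of the complete Bell
polynomials in the moments of the tilted Lévy measure. -/
lemma complexMoment_succ_eq {ν : Measure ℝ≥0} [IsProbabilityMeasure μ]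
    (hν : Integrable (fun r : ℝ≥0 => min 1 (r : ℝ)) ν) {c : ℝ} (hc : 0 ≤ c)
    (h : ∀ u : ℝ, complexMoment μ 0 (u * Complex.I) =
      Complex.exp (c * laplaceExponent ν (u * Complex.I)))
    (n : ℕ) {z : ℂ} (hz : 0 < z.re) :
    complexMoment μ (n + 1) z = c * ∑ p ∈ Finset.HasAntidiagonal.antidiagonal n,
      (n.choose p.1 : ℂ) * (complexMoment μ p.1 z * complexMoment ν (p.2 + 1) z) := by
  have hμ := integrable_min_one_of_isFiniteMeasure (μ := μ)
  have hopen : IsOpen {z : ℂ | 0 < z.re} := isOpen_lt continuous_const Complex.continuous_re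
  have hd0 : ∀ z : ℂ, 0 < z.re → HasDerivAt (complexMoment μ 0) (-complexMoment μ 1 z) z := by
    intro z hz
    refine ((hasDerivAt_laplaceExponent hμ hz).add_const 1).congr_of_eventuallyEq ?_
    filter_upwards [hopen.mem_nhds hz] with w hw
    exact complexMoment_zero_eq (le_of_lt hw)
  have hd : ∀ (k : ℕ) (z : ℂ), 0 < z.re →
      HasDerivAt (complexMoment μ k) (-complexMoment μ (k + 1) z) z := by
    intro k z hz
    cases k with
    | zero => exact hd0 z hz
    | succ k => exact hasDerivAt_complexMoment_succ hμ k hz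
  induction n generalizing z with
  | zero =>
    have h1 : HasDerivAt (complexMoment μ 0)
        (Complex.exp (c * laplaceExponent ν z) * (c * -complexMoment ν 1 z)) z := by
      refine ((hasDerivAt_laplaceExponent hν hz).const_mul (c : ℂ)).cexp.congr_of_eventuallyEq ?_
      filter_upwards [hopen.mem_nhds hz] with w hw
      exact complexMoment_zero_eq_exp hν hc h (le_of_lt hw)
    have h2 := (hd 0 z hz).unique h1
    rw [← complexMoment_zero_eq_exp hν hc h hz.le] at h2
    simp
    linear_combination -h2
  | succ n ih =>
    have h1 : HasDerivAt (complexMoment μ (n + 1)) (c * ∑ p ∈ Finset.HasAntidiagonal.antidiagonal n,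
      (n.choose p.1 : ℂ) * (-complexMoment μ (p.1 + 1) z * complexMoment ν (p.2 + 1) z
        + complexMoment μ p.1 z * -complexMoment ν (p.2 + 2) z)) z := by
      have : HasDerivAt (fun z => c * ∑ p ∈ Finset.HasAntidiagonal.antidiagonal n,
          (n.choose p.1 : ℂ) * (complexMoment μ p.1 z * complexMoment ν (p.2 + 1) z))
          (c * ∑ p ∈ Finset.HasAntidiagonal.antidiagonal n,
            (n.choose p.1 : ℂ) * (-complexMoment μ (p.1 + 1) z * complexMoment ν (p.2 + 1) z
            + complexMoment μ p.1 z * -complexMoment ν (p.2 + 2) z)) z :=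
        (HasDerivAt.fun_sum fun p _ => ((hd p.1 z hz).mul
          (hasDerivAt_complexMoment_succ hν p.2 hz)).const_mul _).const_mul _
      refine this.congr_of_eventuallyEq ?_
      filter_upwards [hopen.mem_nhds hz] with w hw
      exact ih hw
    have h2 := (hd (n + 1) z hz).unique h1
    -- The Leibniz rule has produced two sums over the antidiagonal of `n`; Pascal's rule splits the
    -- target sum for `n + 1` in the same way.
    rw [Finset.sum_antidiagonal_choose_succ_mul
      (fun i j => complexMoment μ i z * complexMoment ν (j + 1) z)]
    have h3 : ∑ p ∈ Finset.HasAntidiagonal.antidiagonal n, (n.choose p.2 : ℂ) *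
        (complexMoment μ (p.1 + 1) z * complexMoment ν (p.2 + 1) z) =
        ∑ p ∈ Finset.HasAntidiagonal.antidiagonal n, (n.choose p.1 : ℂ) *
        (complexMoment μ (p.1 + 1) z * complexMoment ν (p.2 + 1) z) := by
      refine Finset.sum_congr rfl fun p hp => ?_
      rw [Nat.choose_symm_of_eq_add (Finset.HasAntidiagonal.mem_antidiagonal.1 hp).symm]
    rw [h3, ← Finset.sum_add_distrib, neg_eq_iff_eq_neg.1 h2, ← mul_neg, ← Finset.sum_neg_distrib]
    congr 1
    refine Finset.sum_congr rfl fun p _ => ?_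
    ring

/-! ### Complete Bell polynomials and their behaviour for small parameter -/

open Filter Topology

/-- The complete Bell polynomials evaluated at `c * κ 1, c * κ 2, …`. -/
noncomputable def bellPolynomial (κ : ℕ → ℝ) (c : ℝ) : ℕ → ℝ
  | 0 => 1
  | n + 1 => c * ∑ j : Fin (n + 1), (n.choose j : ℝ) * (bellPolynomial κ c j * κ (n - j + 1))

lemma bellPolynomial_zero (κ : ℕ → ℝ) (c : ℝ) : bellPolynomial κ c 0 = 1 := by
  rw [bellPolynomial]

lemma bellPolynomial_succ (κ : ℕ → ℝ) (c : ℝ) (n : ℕ) :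
    bellPolynomial κ c (n + 1) =
      c * ∑ j : Fin (n + 1), (n.choose j : ℝ) * (bellPolynomial κ c j * κ (n - j + 1)) := by
  rw [bellPolynomial]

lemma exists_abs_bellPolynomial_le (κ : ℕ → ℝ) {γ : ℝ} (n : ℕ) :
    ∃ B : ℝ, ∀ c, 0 ≤ c → c ≤ γ → |bellPolynomial κ c n| ≤ B := by
  induction n using Nat.strong_induction_on with
  | _ n ih =>
    cases n with
    | zero => exact ⟨1, fun c _ _ => by simp [bellPolynomial_zero]⟩
    | succ n =>
      choose! B hB using ih
      refine ⟨γ * ∑ j : Fin (n + 1), (n.choose j : ℝ) * (B j * |κ (n - j + 1)|),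
        fun c h0 h1 => ?_⟩
      rw [bellPolynomial_succ, abs_mul, abs_of_nonneg h0]
      refine mul_le_mul h1 ?_ (abs_nonneg _) (h0.trans h1)
      refine (Finset.abs_sum_le_sum_abs _ _).trans (Finset.sum_le_sum fun j _ => ?_)
      rw [abs_mul, abs_mul, Nat.abs_cast]
      gcongr
      exact hB j j.2 c h0 h1

/-- The term `j = 0` of the recursion is exactly `c * κ (n + 1)`. Every other term contains a Bell
polynomial of positive order, itself O(c), besides the prefactor `c`. -/
lemma exists_abs_bellPolynomial_succ_sub_le (κ : ℕ → ℝ) (γ : ℝ) (n : ℕ) :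
    ∃ K : ℝ, ∀ c, 0 ≤ c → c ≤ γ →
      |bellPolynomial κ c (n + 1) - c * κ (n + 1)| ≤ K * c ^ 2 := by
  have key : ∀ j : ℕ, ∃ B : ℝ, ∀ c, 0 ≤ c → c ≤ γ → |bellPolynomial κ c (j + 1)| ≤ B * c := by
    intro j
    have h := fun i => exists_abs_bellPolynomial_le κ (γ := γ) i
    choose B hB using h
    refine ⟨∑ i : Fin (j + 1), (j.choose i : ℝ) * (B i * |κ (j - i + 1)|), fun c h0 h1 => ?_⟩
    rw [bellPolynomial_succ, abs_mul, abs_of_nonneg h0, mul_comm]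
    refine mul_le_mul_of_nonneg_right ?_ h0
    refine (Finset.abs_sum_le_sum_abs _ _).trans (Finset.sum_le_sum fun i _ => ?_)
    rw [abs_mul, abs_mul, Nat.abs_cast]
    gcongr
    exact hB i c h0 h1
  choose B hB using key
  refine ⟨∑ j : Fin n, (n.choose (j + 1) : ℝ) * (B j * |κ (n - (j + 1) + 1)|),
    fun c h0 h1 => ?_⟩
  rw [bellPolynomial_succ, Fin.sum_univ_succ]
  simp only [Fin.val_zero, Nat.choose_zero_right, Nat.cast_one, bellPolynomial_zero, one_mul,
    Nat.sub_zero, Fin.val_succ, mul_add, add_sub_cancel_left]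
  rw [abs_mul, abs_of_nonneg h0, pow_two, mul_comm c, ← mul_assoc]
  refine mul_le_mul_of_nonneg_right ?_ h0
  rw [Finset.sum_mul]
  refine (Finset.abs_sum_le_sum_abs _ _).trans (Finset.sum_le_sum fun i _ => ?_)
  rw [abs_mul, abs_mul, Nat.abs_cast, mul_assoc]
  refine mul_le_mul_of_nonneg_left ?_ (Nat.cast_nonneg _)
  rw [mul_right_comm]
  exact mul_le_mul_of_nonneg_right (hB i c h0 h1) (abs_nonneg _)

lemma complexMoment_one_eq (μ : Measure ℝ≥0) (n : ℕ) :
    complexMoment μ n 1 = (tiltedMoment μ n : ℂ) := by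
  rw [complexMoment, tiltedMoment, ← integral_complex_ofReal]
  simp

lemma laplaceExponent_one_eq (μ : Measure ℝ≥0) :
    laplaceExponent μ 1 = ((∫ r, (Real.exp (-(r : ℝ)) - 1) ∂μ : ℝ) : ℂ) := by
  rw [laplaceExponent, ← integral_complex_ofReal]
  simp

section

variable {μ ν : Measure ℝ≥0} [IsProbabilityMeasure μ]

lemma tiltedMoment_zero_eq_exp (hν : Integrable (fun r : ℝ≥0 => min 1 (r : ℝ)) ν) {c : ℝ}
    (hc : 0 ≤ c) (h : ∀ u : ℝ, complexMoment μ 0 (u * Complex.I) =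
      Complex.exp (c * laplaceExponent ν (u * Complex.I))) :
    tiltedMoment μ 0 = Real.exp (c * ∫ r, (Real.exp (-(r : ℝ)) - 1) ∂ν) := by
  have := complexMoment_zero_eq_exp hν hc h (z := 1) (by simp)
  rw [complexMoment_one_eq, laplaceExponent_one_eq] at this
  exact_mod_cast this

lemma tiltedMoment_eq_bellPolynomial_mul
    (hν : Integrable (fun r : ℝ≥0 => min 1 (r : ℝ)) ν) {c : ℝ}
    (hc : 0 ≤ c) (h : ∀ u : ℝ, complexMoment μ 0 (u * Complex.I) =
      Complex.exp (c * laplaceExponent ν (u * Complex.I))) (n : ℕ) :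
    tiltedMoment μ n = bellPolynomial (tiltedMoment ν) c n * tiltedMoment μ 0 := by
  induction n using Nat.strong_induction_on with
  | _ n ih =>
    cases n with
    | zero => rw [bellPolynomial_zero, one_mul]
    | succ n =>
      have := complexMoment_succ_eq hν hc h n (z := 1) (by simp)
      simp only [complexMoment_one_eq] at this
      norm_cast at this
      rw [this, bellPolynomial_succ,
        Finset.Nat.sum_antidiagonal_eq_sum_range_succ_mk, Finset.sum_range, mul_assoc,
        Finset.sum_mul]
      congr 1
      refine Finset.sum_congr rfl fun j _ => ?_
      rw [ih j j.2]
      ring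

end

/-! ### Sums over injective assignments of clusters to cells -/

section

variable {V ι : Type*} [Fintype V] [DecidableEq V] [Fintype ι] [DecidableEq ι]

/-- Summing over the common value `b` at `v` and `w` makes the coordinates independent again; the
two tied ones contribute `g b ^ 2`. -/
lemma sum_prod_of_apply_eq_apply (g : ι → ℝ) {v w : V} (hvw : v ≠ w) :
    ∑ a : V → ι with a v = a w, ∏ u, g (a u) =
      (∑ b, g b ^ 2) * (∑ b, g b) ^ (Finset.univ.filter fun u => ¬ (u = v ∨ u = w)).card := by
  have h2 : (Finset.univ.filter fun u => u = v ∨ u = w).card = 2 := by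
    rw [← Finset.card_pair hvw]
    congr 1
    ext u
    simp
  calc ∑ a : V → ι with a v = a w, ∏ u, g (a u)
      = ∑ a : V → ι, ∑ b, ∏ u, if u = v ∨ u = w then (if a u = b then g (a u) else 0)
          else g (a u) := by
        rw [Finset.sum_filter]
        refine Finset.sum_congr rfl fun a _ => ?_
        split_ifs with h
        · rw [Finset.sum_eq_single (a v)]
          · refine Finset.prod_congr rfl fun u _ => ?_
            split_ifs with h1 h3
            · rfl
            · rcases h1 with rfl | rfl
              · exact absurd rfl h3
              · exact absurd h.symm h3
            · rfl
          · intro b _ hb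
            exact Finset.prod_eq_zero (Finset.mem_univ v) (by simp [hb.symm])
          · simp
        · refine (Finset.sum_eq_zero fun b _ => ?_).symm
          by_cases hb : a v = b
          · exact Finset.prod_eq_zero (Finset.mem_univ w) (by simp [← hb, Ne.symm h])
          · exact Finset.prod_eq_zero (Finset.mem_univ v) (by simp [hb])
    _ = ∑ b, ∏ u, ∑ x, if u = v ∨ u = w then (if x = b then g x else 0) else g x := by
        rw [Finset.sum_comm]
        refine Finset.sum_congr rfl fun b _ => ?_
        rw [Finset.prod_univ_sum, Fintype.piFinset_univ]
    _ = ∑ b, ∏ u, if u = v ∨ u = w then g b else ∑ x, g x := by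
        refine Finset.sum_congr rfl fun b _ => Finset.prod_congr rfl fun u _ => ?_
        split_ifs
        · simp
        · rfl
    _ = _ := by
        simp only [Finset.prod_ite, Finset.prod_const, h2, Finset.sum_mul]

end

/-- Without injectivity the sum is a product of sums over cells, each tending to `γ * κ v`. A
non-injective assignment has a colliding pair, and each pair costs a factor ∑ g², which vanishes in
the limit. -/
lemma tendsto_sum_injective_prod {V : Type*} [Fintype V] [DecidableEq V] {ι : ℕ → Type*}
    [∀ N, Fintype (ι N)] [∀ N, DecidableEq (ι N)] {g : ∀ N, ι N → ℝ} (hg : ∀ N b, 0 ≤ g N b)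
    {γ : ℝ} (hsum : ∀ N, ∑ b, g N b = γ)
    (hsq : Tendsto (fun N => ∑ b, g N b ^ 2) atTop (𝓝 0))
    {x : ∀ N, V → ι N → ℝ} {κ : V → ℝ} {K : ℝ}
    (hx : ∀ N v b, |x N v b - g N b * κ v| ≤ K * g N b ^ 2) :
    Tendsto (fun N => ∑ a : V → ι N with Function.Injective a, ∏ v, x N v (a v)) atTop
      (𝓝 (∏ v, γ * κ v)) := by
  classical
  have hγ : 0 ≤ γ := by rw [← hsum 0]; exact Finset.sum_nonneg fun b _ => hg 0 b
  have hle : ∀ N b, g N b ≤ γ := fun N b => by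
    rw [← hsum N]
    exact Finset.single_le_sum (fun b _ => hg N b) (Finset.mem_univ b)
  -- Chosen so that `|x| ≤ K' * g`: the linear term contributes the sum of `|κ v|`, and `g ^ 2 ≤ γ *
  -- g` absorbs the quadratic error.
  set K' : ℝ := ∑ v, |κ v| + |K| * γ
  have hK' : 0 ≤ K' := by positivity
  have hx' : ∀ N v b, |x N v b| ≤ K' * g N b := by
    intro N v b
    have h1 : |x N v b| ≤ |x N v b - g N b * κ v| + |g N b * κ v| := by
      have := abs_add_le (x N v b - g N b * κ v) (g N b * κ v)
      simpa using this
    rw [abs_mul, abs_of_nonneg (hg N b)] at h1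
    have h2 : |κ v| ≤ ∑ v, |κ v| :=
      Finset.single_le_sum (fun v _ => abs_nonneg (κ v)) (Finset.mem_univ v)
    have h3 : K * g N b ^ 2 ≤ |K| * γ * g N b := by
      rw [pow_two, mul_assoc]
      exact mul_le_mul (le_abs_self K) (mul_le_mul_of_nonneg_right (hle N b) (hg N b))
        (mul_nonneg (hg N b) (hg N b)) (abs_nonneg K)
    have h4 := mul_le_mul_of_nonneg_left h2 (hg N b)
    have := hx N v b
    simp only [K']
    nlinarith
  have hall : Tendsto (fun N => ∑ a : V → ι N, ∏ v, x N v (a v)) atTop (𝓝 (∏ v, γ * κ v)) := by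
    have : ∀ N, ∑ a : V → ι N, ∏ v, x N v (a v) = ∏ v, ∑ b, x N v b := fun N => by
      rw [Finset.prod_univ_sum, Fintype.piFinset_univ]
    simp only [this]
    refine tendsto_finsetProd _ fun v _ => ?_
    rw [tendsto_iff_norm_sub_tendsto_zero]
    refine squeeze_zero (fun N => norm_nonneg _) (fun N => ?_)
      (by simpa using hsq.const_mul K)
    rw [← hsum N, Finset.sum_mul, ← Finset.sum_sub_distrib, Real.norm_eq_abs, Finset.mul_sum]
    exact (Finset.abs_sum_le_sum_abs _ _).trans (Finset.sum_le_sum fun b _ => hx N v b)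
  have hnot : Tendsto (fun N => ∑ a : V → ι N with ¬ Function.Injective a, ∏ v, x N v (a v))
      atTop (𝓝 0) := by
    rw [tendsto_zero_iff_norm_tendsto_zero]
    refine squeeze_zero (fun N => norm_nonneg _) (g := fun N => K' ^ Fintype.card V *
      ∑ p : V × V with p.1 ≠ p.2, (∑ b, g N b ^ 2) *
        γ ^ (Finset.univ.filter fun u => ¬ (u = p.1 ∨ u = p.2)).card) (fun N => ?_) ?_
    · calc ‖∑ a : V → ι N with ¬ Function.Injective a, ∏ v, x N v (a v)‖
          ≤ ∑ a : V → ι N with ¬ Function.Injective a, K' ^ Fintype.card V * ∏ v, g N (a v) := by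
            refine (norm_sum_le _ _).trans (Finset.sum_le_sum fun a _ => ?_)
            rw [norm_prod, Fintype.card, ← Finset.prod_const, ← Finset.prod_mul_distrib]
            exact Finset.prod_le_prod (fun v _ => norm_nonneg _) fun v _ => hx' N v (a v)
        _ = K' ^ Fintype.card V *
            ∑ a : V → ι N with ¬ Function.Injective a, ∏ v, g N (a v) := by
            rw [Finset.mul_sum]
        _ ≤ K' ^ Fintype.card V * ∑ p : V × V with p.1 ≠ p.2,
              ∑ a : V → ι N with a p.1 = a p.2, ∏ v, g N (a v) := by
            refine mul_le_mul_of_nonneg_left ?_ (by positivity)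
            have hnn : ∀ a : V → ι N, 0 ≤ ∏ v, g N (a v) :=
              fun a => Finset.prod_nonneg fun v _ => hg N _
            simp only [Finset.sum_filter (s := (Finset.univ : Finset (V → ι N)))]
            rw [Finset.sum_comm]
            refine Finset.sum_le_sum fun a _ => ?_
            have hnn' : ∀ p ∈ Finset.univ.filter fun p : V × V => p.1 ≠ p.2,
                0 ≤ if a p.1 = a p.2 then ∏ v, g N (a v) else 0 := fun p _ => by
              split_ifs
              exacts [hnn a, le_rfl]
            split_ifs with ha
            · exact Finset.sum_nonneg hnn'
            · obtain ⟨v, w, h1, h2⟩ := Function.not_injective_iff.1 ha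
              refine le_trans ?_ (Finset.single_le_sum hnn' (a := (v, w)) (by simpa using h2))
              simp [h1]
        _ = _ := by
            congr 1
            refine Finset.sum_congr rfl fun p hp => ?_
            rw [sum_prod_of_apply_eq_apply (g N) (Finset.mem_filter.1 hp).2, hsum]
    · have : Tendsto (fun N => K' ^ Fintype.card V *
          ∑ p : V × V with p.1 ≠ p.2, (∑ b, g N b ^ 2) *
          γ ^ (Finset.univ.filter fun u => ¬ (u = p.1 ∨ u = p.2)).card) atTop
          (𝓝 (K' ^ Fintype.card V * ∑ p : V × V with p.1 ≠ p.2, 0 *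
          γ ^ (Finset.univ.filter fun u => ¬ (u = p.1 ∨ u = p.2)).card)) :=
        (tendsto_finsetSum _ fun p _ => hsq.mul_const _).const_mul _
      simpa using this
  have := hall.sub hnot
  rw [sub_zero] at this
  refine this.congr fun N => ?_
  rw [sub_eq_iff_eq_add, Finset.sum_filter_add_sum_filter_not]


/-! ### Label patterns and numbering by order of appearance -/

/-- Two families induce the same partition of their index set. -/
def SamePattern {ι α β : Type*} (c : ι → α) (q : ι → β) : Prop := ∀ i j, c i = c j ↔ q i = q j

namespace SamePattern

variable {ι α β γ : Type*} {c : ι → α} {q : ι → β} {p : ι → γ}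

lemma symm (h : SamePattern c q) : SamePattern q c := fun i j => (h i j).symm

lemma trans (h : SamePattern c q) (h' : SamePattern q p) : SamePattern c p :=
  fun i j => (h i j).trans (h' i j)

lemma exists_comp_eq [Nonempty β] (h : SamePattern c q) : ∃ g : α → β, q = g ∘ c :=
  (Function.factorsThrough_iff q).1 fun i j hij => (h i j).1 hij

lemma card_image_le [DecidableEq α] [DecidableEq β] (h : SamePattern c q) (s : Finset ι) :
    (s.image q).card ≤ (s.image c).card := by
  rcases isEmpty_or_nonempty ι with hι | ⟨⟨i⟩⟩
  · simp [Finset.eq_empty_of_isEmpty s]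
  · have : Nonempty β := ⟨q i⟩
    obtain ⟨g, rfl⟩ := h.exists_comp_eq
    rw [← Finset.image_image]
    exact Finset.card_image_le

lemma card_image_eq [DecidableEq α] [DecidableEq β] (h : SamePattern c q) (s : Finset ι) :
    (s.image c).card = (s.image q).card :=
  le_antisymm (h.symm.card_image_le s) (h.card_image_le s)

end SamePattern

section Labels

variable {n : ℕ}

lemma appearanceLabel_congr {c q : Fin n → ℕ} (h : SamePattern c q) :
    appearanceLabel c = appearanceLabel q := by
  funext i
  unfold appearanceLabel
  rw [h.card_image_eq]
  congr 2
  ext j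
  simp only [Finset.mem_filter, h _ i]

lemma exists_first (c : Fin n → ℕ) (i : Fin n) :
    ∃ a, c a = c i ∧ ∀ j, c j = c i → a ≤ j := by
  have hne : (Finset.univ.filter fun j => c j = c i).Nonempty := ⟨i, by simp⟩
  refine ⟨_, (Finset.mem_filter.1 (Finset.min'_mem _ hne)).2, fun j hj => ?_⟩
  exact Finset.min'_le _ _ (by simpa using hj)

/-- Positions counted for `i` are at most `a`. The first occurrence `b` of `c j` comes later, so its
value is counted for `j` only. -/
lemma appearanceLabel_lt {c : Fin n → ℕ} {i j a b : Fin n} (hac : c a = c i)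
    (hb : ∀ j', c j' = c j → b ≤ j') (hbc : c b = c j)
    (hab : a < b) : appearanceLabel c i < appearanceLabel c j := by
  refine Finset.card_lt_card (Finset.ssubset_iff_of_subset (Finset.image_subset_image ?_) |>.2 ?_)
  · intro k hk
    simp only [Finset.mem_filter, Finset.mem_univ, true_and] at hk ⊢
    exact fun i' hi' => (hk a hac).trans (hab.le.trans (hb i' hi'))
  · refine ⟨c b, Finset.mem_image_of_mem c ?_, ?_⟩
    · simpa using hb
    · simp only [Finset.mem_image, Finset.mem_filter, Finset.mem_univ, true_and, not_exists,
        not_and]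
      intro k hk hkb
      exact absurd (hb k (hkb.trans hbc)) (not_le.2 ((hk a hac).trans_lt hab))

lemma samePattern_appearanceLabel (c : Fin n → ℕ) : SamePattern (appearanceLabel c) c := by
  intro i j
  obtain ⟨a, ha, ha'⟩ := exists_first c i
  obtain ⟨b, hb, hb'⟩ := exists_first c j
  constructor
  · intro h
    rcases lt_trichotomy a b with hab | rfl | hab
    · exact absurd h (appearanceLabel_lt ha hb' hb hab).ne
    · rw [← ha, hb]
    · exact absurd h (appearanceLabel_lt hb ha' ha hab).ne'
  · intro h
    simp only [appearanceLabel, h]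

lemma appearanceLabel_mem_Icc (c : Fin n → ℕ) (i : Fin n) :
    appearanceLabel c i ∈ Finset.Icc 1 (numClusters c) := by
  rw [Finset.mem_Icc]
  refine ⟨?_, Finset.card_le_card (Finset.image_subset_image (Finset.filter_subset _ _))⟩
  obtain ⟨a, ha, ha'⟩ := exists_first c i
  exact Finset.card_pos.2 ⟨c a, Finset.mem_image_of_mem c (by simpa using ha')⟩

lemma image_appearanceLabel (c : Fin n → ℕ) :
    Finset.univ.image (appearanceLabel c) = Finset.Icc 1 (numClusters c) := by
  refine Finset.eq_of_subset_of_card_le ?_ ?_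
  · exact Finset.image_subset_iff.2 fun i _ => appearanceLabel_mem_Icc c i
  · rw [(samePattern_appearanceLabel c).card_image_eq]
    simp [numClusters]

lemma appearanceLabel_snoc_castSucc (e : Fin n → ℕ) (x : ℕ) (j : Fin n) :
    appearanceLabel (Fin.snoc (α := fun _ => ℕ) e x) j.castSucc = appearanceLabel e j := by
  unfold appearanceLabel
  have : (Finset.univ.filter fun j' : Fin (n + 1) => ∀ i', Fin.snoc (α := fun _ => ℕ) e x i' =
      Fin.snoc (α := fun _ => ℕ) e x j.castSucc → j' ≤ i') =
      (Finset.univ.filter fun j' : Fin n => ∀ i', e i' = e j → j' ≤ i').image Fin.castSucc := by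
    ext j'
    simp only [Finset.mem_filter, Finset.mem_univ, true_and, Finset.mem_image]
    constructor
    · intro h
      have hj' := h j.castSucc rfl
      obtain ⟨k, rfl⟩ : ∃ k : Fin n, k.castSucc = j' :=
        Fin.exists_castSucc_eq.2 (hj'.trans_lt (Fin.castSucc_lt_last j)).ne
      refine ⟨k, fun i' hi' => ?_, rfl⟩
      exact Fin.castSucc_le_castSucc_iff.1 (h i'.castSucc (by simpa using hi'))
    · rintro ⟨k, hk, rfl⟩ i' hi'
      induction i' using Fin.lastCases with
      | last => exact Fin.le_last _
      | cast i' => exact Fin.castSucc_le_castSucc_iff.2 (hk i' (by simpa using hi'))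
  rw [this, Finset.image_image]
  congr 2
  funext k
  simp

lemma numClusters_snoc_le (e : Fin n → ℕ) (x : ℕ) :
    numClusters (Fin.snoc (α := fun _ => ℕ) e x) ≤ numClusters e + 1 := by
  have : Finset.univ.image (Fin.snoc (α := fun _ => ℕ) e x) ⊆
      insert x (Finset.univ.image e) := by
    intro v hv
    obtain ⟨i, -, rfl⟩ := Finset.mem_image.1 hv
    induction i using Fin.lastCases with
    | last => simp
    | cast i => simp
  exact (Finset.card_le_card this).trans (Finset.card_insert_le _ _)

lemma numClusters_appearanceLabel (c : Fin n → ℕ) :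
    numClusters (appearanceLabel c) = numClusters c :=
  (samePattern_appearanceLabel c).card_image_eq _

lemma labelOf_mem_Icc {i : Fin (n + 1)} {c : Fin (n + 1) → ℕ} {y : Fin n → ℕ}
    (h : labelsWithout i c = y) : labelOf i c ∈ Finset.Icc 1 (numClusters y + 1) := by
  have h1 := Finset.mem_Icc.1 (appearanceLabel_mem_Icc
    (Fin.snoc (α := fun _ => ℕ) (i.removeNth c) (c i)) (Fin.last n))
  rw [← h, labelsWithout, numClusters_appearanceLabel]
  exact Finset.mem_Icc.2 ⟨h1.1, h1.2.trans (numClusters_snoc_le _ _)⟩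

lemma samePattern_insertNth_iff {i : Fin (n + 1)} {c : Fin (n + 1) → ℕ} {k : ℕ} {y : Fin n → ℕ} :
    SamePattern c (i.insertNth (α := fun _ => ℕ) k y) ↔
      SamePattern (i.removeNth c) y ∧ ∀ j, c i = i.removeNth c j ↔ k = y j := by
  constructor
  · intro h
    exact ⟨fun j j' => by simpa [Fin.removeNth] using h (i.succAbove j) (i.succAbove j'),
      fun j => by simpa [Fin.removeNth] using h i (i.succAbove j)⟩
  · rintro ⟨h1, h2⟩ a b
    induction a using Fin.succAboveCases i with
    | x =>
      induction b using Fin.succAboveCases i with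
      | x => simp
      | p j => simpa [Fin.removeNth] using h2 j
    | p j =>
      induction b using Fin.succAboveCases i with
      | x => rw [eq_comm, eq_comm (b := i.insertNth (α := fun _ => ℕ) k y i)]; simpa [Fin.removeNth] using h2 j
      | p j' => simpa [Fin.removeNth] using h1 j j'

lemma samePattern_insertNth_labelOf (i : Fin (n + 1)) (c : Fin (n + 1) → ℕ) :
    SamePattern c (i.insertNth (α := fun _ => ℕ) (labelOf i c) (labelsWithout i c)) := by
  refine samePattern_insertNth_iff.2 ⟨(samePattern_appearanceLabel _).symm, fun j => ?_⟩
  have := samePattern_appearanceLabel (Fin.snoc (α := fun _ => ℕ) (i.removeNth c) (c i))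
    (Fin.last n) j.castSucc
  rw [appearanceLabel_snoc_castSucc] at this
  simpa [labelOf, labelsWithout] using this.symm

/-- Turns the events of the theorem into partition events. The hypothesis `hy` ensures that `y` is
numbered by appearance; otherwise a pattern would not determine the numbers. -/
lemma labels_eq_iff_samePattern {i : Fin (n + 1)} {c c₀ : Fin (n + 1) → ℕ} {y : Fin n → ℕ}
    (hy : labelsWithout i c₀ = y) {k : ℕ} (hk : k ∈ Finset.Icc 1 (numClusters y + 1)) :
    labelsWithout i c = y ∧ labelOf i c = k ↔
      SamePattern c (i.insertNth (α := fun _ => ℕ) k y) := by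
  constructor
  · rintro ⟨rfl, rfl⟩
    exact samePattern_insertNth_labelOf i c
  · intro h
    have h1 := samePattern_insertNth_iff.1 h
    have hl : labelsWithout i c = y := by
      rw [← hy]
      refine appearanceLabel_congr (h1.1.trans ?_)
      rw [← hy]
      exact samePattern_appearanceLabel _
    refine ⟨hl, ?_⟩
    have h2 := samePattern_insertNth_iff.1 (samePattern_insertNth_labelOf i c)
    rw [hl] at h2
    have h3 : ∀ j, labelOf i c = y j ↔ k = y j := fun j => (h2.2 j).symm.trans (h1.2 j)
    have hr : ∀ v, (∃ j, v = y j) ↔ v ∈ Finset.Icc 1 (numClusters y) := by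
      intro v
      rw [← hy, labelsWithout, numClusters_appearanceLabel, ← image_appearanceLabel]
      simp [eq_comm]
    have h4 := labelOf_mem_Icc hl
    -- An existing number is pinned down by some `j` with `k = y j`; outside the existing range only
    -- `numClusters y + 1` remains.
    by_cases hkl : k ∈ Finset.Icc 1 (numClusters y)
    · obtain ⟨j, hj⟩ := (hr k).2 hkl
      rw [(h3 j).2 hj, hj]
    · have h5 : labelOf i c ∉ Finset.Icc 1 (numClusters y) := by
        rw [← hr] at hkl ⊢
        simpa [h3] using hkl
      simp only [Finset.mem_Icc] at hk hkl h4 h5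
      omega

lemma clusterSize_insertNth (i : Fin (n + 1)) (k : ℕ) (y : Fin n → ℕ) (v : ℕ) :
    clusterSize (i.insertNth (α := fun _ => ℕ) k y) v =
      clusterSize y v + if k = v then 1 else 0 := by
  simp only [clusterSize, Finset.card_filter]
  rw [Fin.sum_univ_succAbove _ i, add_comm]
  simp

lemma image_insertNth (i : Fin (n + 1)) (k : ℕ) (y : Fin n → ℕ) :
    Finset.univ.image (i.insertNth (α := fun _ => ℕ) k y) = insert k (Finset.univ.image y) := by
  ext v
  simp only [Finset.mem_image, Finset.mem_univ, true_and, Finset.mem_insert]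
  rw [Fin.exists_iff_succAbove i]
  simp [eq_comm]

end Labels

variable {S Ω : Type*} [MeasurableSpace S] [MeasurableSpace Ω]

/-! ### Refining finite partitions of Ω and the absence of atoms -/

section Cells

/-- The cell of a point in the partition given by the first `N` binary features. -/
def cell (f : Ω → ℕ → Bool) (N : ℕ) (ω : Ω) : Fin N → Bool := fun j => f ω j

lemma measurable_cell {f : Ω → ℕ → Bool} (hf : Measurable f) (N : ℕ) : Measurable (cell f N) :=
  measurable_pi_lambda _ fun j => (measurable_pi_apply (j : ℕ)).comp hf

omit [MeasurableSpace Ω] in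
lemma eventually_cell_eq_iff {f : Ω → ℕ → Bool} (hf : Function.Injective f) (x y : Ω) :
    ∀ᶠ N in atTop, cell f N x = cell f N y ↔ x = y := by
  by_cases h : x = y
  · simp [h]
  · obtain ⟨k, hk⟩ : ∃ k, f x k ≠ f y k := Function.ne_iff.1 (hf.ne h)
    filter_upwards [eventually_gt_atTop k] with N hN
    refine iff_of_false (fun hxy => hk ?_) h
    exact congrFun hxy ⟨k, hN⟩

lemma prod_setOf_eq {ι : Type*} [Fintype ι] [DecidableEq ι] [MeasurableSpace ι]
    [MeasurableSingletonClass ι] {φ : Ω → ι} (hφ : Measurable φ) (G₀ : Measure Ω)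
    [IsFiniteMeasure G₀] :
    (G₀.prod G₀) {p | φ p.1 = φ p.2} = ∑ b, G₀ (φ ⁻¹' {b}) ^ 2 := by
  have : {p : Ω × Ω | φ p.1 = φ p.2} = ⋃ b, (φ ⁻¹' {b}) ×ˢ (φ ⁻¹' {b}) := by
    ext p
    simp [eq_comm]
  rw [this, measure_iUnion, tsum_fintype]
  · simp [Measure.prod_prod, pow_two]
  · intro b b' hbb'
    refine Set.disjoint_left.2 fun p hp hp' => hbb' ?_
    rw [← hp.1, ← hp'.1]
  · exact fun b => (hφ (measurableSet_singleton b)).prod (hφ (measurableSet_singleton b))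

/-- The sum is the `G₀ × G₀` mass of pairs sharing a cell. These sets decrease to the diagonal,
which is null by Fubini because points are null. -/
lemma tendsto_sum_sq_cell {f : Ω → ℕ → Bool} (hf : Measurable f) (hinj : Function.Injective f)
    (G₀ : Measure Ω) [IsFiniteMeasure G₀] [NullSingletonClass G₀] :
    Tendsto (fun N => ∑ b, G₀.real (cell f N ⁻¹' {b}) ^ 2) atTop (𝓝 0) := by
  have hmeas : ∀ N, MeasurableSet {p : Ω × Ω | cell f N p.1 = cell f N p.2} := fun N =>
    measurableSet_eq_fun ((measurable_cell hf N).comp measurable_fst)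
      ((measurable_cell hf N).comp measurable_snd)
  have hanti : Antitone fun N => {p : Ω × Ω | cell f N p.1 = cell f N p.2} := by
    intro M N hMN p hp
    funext j
    exact congrFun hp (Fin.castLE hMN j)
  have hinter : ⋂ N, {p : Ω × Ω | cell f N p.1 = cell f N p.2} = {p | p.1 = p.2} := by
    ext p
    simp only [Set.mem_iInter, Set.mem_ofPred_eq]
    refine ⟨fun h => ?_, fun h N => by rw [h]⟩
    obtain ⟨N, hN⟩ := (eventually_cell_eq_iff hinj p.1 p.2).exists
    exact hN.1 (h N)
  have hzero : (G₀.prod G₀) {p | p.1 = p.2} = 0 := by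
    rw [Measure.prod_apply]
    · refine (lintegral_congr fun x => ?_).trans lintegral_zero
      have : Prod.mk x ⁻¹' {p : Ω × Ω | p.1 = p.2} = {x} := by ext y; simp [eq_comm]
      rw [this, measure_singleton]
    · rw [← hinter]
      exact MeasurableSet.iInter hmeas
  have h := tendsto_measure_iInter_atTop (μ := G₀.prod G₀) (fun N => (hmeas N).nullMeasurableSet)
    hanti ⟨0, measure_ne_top _ _⟩
  rw [hinter, hzero] at h
  have h2 := (ENNReal.tendsto_toReal ENNReal.zero_ne_top).comp h
  refine h2.congr fun N => ?_
  simp only [Function.comp_apply]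
  rw [prod_setOf_eq (measurable_cell hf N), ENNReal.toReal_sum fun b _ => by finiteness]
  simp [measureReal_def]

lemma sum_measure_fiber {ι : Type*} [Fintype ι] [MeasurableSpace ι]
    [MeasurableSingletonClass ι] {φ : Ω → ι} (hφ : Measurable φ) (μ : Measure Ω) :
    ∑ b, μ (φ ⁻¹' {b}) = μ Set.univ := by
  rw [sum_measure_preimage_singleton _ fun b _ => hφ (measurableSet_singleton b)]
  simp

end Cells

/-! ### Tilted moments of a completely random measure -/

section CompletelyRandomMeasure

variable {ρ : Measure ℝ≥0} {G₀ : Measure Ω} [IsFiniteMeasure G₀]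

lemma map_fst_restrict_prod (A : Set Ω) :
    ((ρ.prod G₀).restrict (Set.univ ×ˢ A)).map Prod.fst = G₀ A • ρ := by
  ext s hs
  rw [Measure.map_apply measurable_fst hs, Measure.restrict_apply (measurable_fst hs)]
  have : Prod.fst ⁻¹' s ∩ Set.univ ×ˢ A = s ×ˢ A := by
    ext p; simp
  rw [this, Measure.prod_prod]
  simp [mul_comm]

/-- If `G₀ = 0` the Lévy condition says nothing about `ρ`, so that case is treated separately later.
-/
lemma integrable_min_one_of_lintegral_prod (h0 : G₀ ≠ 0)
    (h : ∫⁻ p, ((min 1 p.1 : ℝ≥0) : ℝ≥0∞) ∂(ρ.prod G₀) < ∞) :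
    Integrable (fun r : ℝ≥0 => min 1 (r : ℝ)) ρ := by
  have h1 : ∫⁻ r, ((min 1 r : ℝ≥0) : ℝ≥0∞) ∂((ρ.prod G₀).map Prod.fst) < ∞ := by
    rwa [lintegral_map (by fun_prop) measurable_fst]
  rw [Measure.map_fst_prod, lintegral_smul_measure, smul_eq_mul] at h1
  have h2 : ∫⁻ r, ((min 1 r : ℝ≥0) : ℝ≥0∞) ∂ρ < ∞ := by
    refine lt_top_iff_ne_top.2 fun h3 => ?_
    rw [h3, ENNReal.mul_top (by simpa using h0)] at h1
    exact lt_irrefl _ h1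
  refine ⟨by fun_prop, ?_⟩
  rw [hasFiniteIntegral_iff_ofReal (ae_of_all _ fun r => le_min zero_le_one r.coe_nonneg)]
  refine lt_of_eq_of_lt (lintegral_congr fun r => ?_) h2
  rw [← ENNReal.ofReal_coe_nnreal, NNReal.coe_min, NNReal.coe_one]

variable {P : Measure S} [IsProbabilityMeasure P] {G : S → Measure Ω}

namespace IsCompletelyRandomMeasure

omit [IsFiniteMeasure G₀] [IsProbabilityMeasure P] in
lemma measurable_apply (hG : IsCompletelyRandomMeasure (ρ.prod G₀) P G) {A : Set Ω}
    (hA : MeasurableSet A) : Measurable fun s => G s A :=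
  (Measure.measurable_coe hA).comp hG.measurable

omit [IsFiniteMeasure G₀] [IsProbabilityMeasure P] in
lemma measurable_toNNReal (hG : IsCompletelyRandomMeasure (ρ.prod G₀) P G) {A : Set Ω}
    (hA : MeasurableSet A) : Measurable fun s => (G s A).toNNReal :=
  (hG.measurable_apply hA).ennreal_toNNReal

omit [IsProbabilityMeasure P] in
lemma complexMoment_map_eq_exp (hG : IsCompletelyRandomMeasure (ρ.prod G₀) P G) {A : Set Ω}
    (hA : MeasurableSet A) (u : ℝ) :
    complexMoment (P.map fun s => (G s A).toNNReal) 0 (u * Complex.I) =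
      Complex.exp ((G₀.real A : ℝ) * laplaceExponent ρ (u * Complex.I)) := by
  have h := hG.charFun A hA (-u)
  rw [complexMoment, integral_map (hG.measurable_toNNReal hA).aemeasurable (by fun_prop)]
  -- The sign of `u` is flipped because the Laplace transform at `u * I` involves `exp (-(i u r))`.
  -- By homogeneity, `A` enters only through its `G₀`-mass.
  have h1 : ∫ p in Set.univ ×ˢ A,
      (Complex.exp (Complex.I * (-u : ℝ) * ((p.1 : ℝ) : ℂ)) - 1) ∂(ρ.prod G₀) =
      (G₀.real A : ℝ) * laplaceExponent ρ (u * Complex.I) := by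
    have h2 := integral_map (μ := (ρ.prod G₀).restrict (Set.univ ×ˢ A))
      (φ := Prod.fst) (f := fun r : ℝ≥0 => Complex.exp (-(u * Complex.I * ((r : ℝ) : ℂ))) - 1)
      measurable_fst.aemeasurable (by fun_prop)
    rw [map_fst_restrict_prod, integral_smul_measure] at h2
    rw [laplaceExponent, measureReal_def, ← Complex.real_smul, h2]
    congr 1
    funext p
    congr 2
    push_cast
    ring
  rw [h1] at h
  rw [← h]
  congr 1
  funext s
  rw [pow_zero, one_mul]
  congr 1
  simp only [ENNReal.toReal]
  push_cast
  ring

lemma integral_pow_mul_exp (hG : IsCompletelyRandomMeasure (ρ.prod G₀) P G)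
    (hρ : Integrable (fun r : ℝ≥0 => min 1 (r : ℝ)) ρ) {A : Set Ω}
    (hA : MeasurableSet A) (n : ℕ) :
    ∫ s, (G s A).toReal ^ n * Real.exp (-(G s A).toReal) ∂P =
      bellPolynomial (tiltedMoment ρ) (G₀.real A) n *
        Real.exp (G₀.real A * ∫ r, (Real.exp (-(r : ℝ)) - 1) ∂ρ) := by
  have hm := hG.measurable_toNNReal hA
  have : IsProbabilityMeasure (P.map fun s => (G s A).toNNReal) :=
    Measure.isProbabilityMeasure_map hm.aemeasurable
  have h := hG.complexMoment_map_eq_exp hA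
  have h1 := tiltedMoment_eq_bellPolynomial_mul hρ measureReal_nonneg h n
  rw [tiltedMoment_zero_eq_exp hρ measureReal_nonneg h, tiltedMoment,
    integral_map hm.aemeasurable (by fun_prop)] at h1
  exact h1

omit [IsFiniteMeasure G₀] [IsProbabilityMeasure P] in
lemma iIndepFun_fiber (hG : IsCompletelyRandomMeasure (ρ.prod G₀) P G)
    {ι : Type*} [Fintype ι] [MeasurableSpace ι]
    [MeasurableSingletonClass ι] {φ : Ω → ι} (hφ : Measurable φ) :
    iIndepFun (fun b s => G s (φ ⁻¹' {b})) P := by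
  have e := Fintype.equivFin ι
  have := (hG.indep _ (fun j => φ ⁻¹' {e.symm j})
    (fun j => hφ (measurableSet_singleton _)) fun i j hij => ?_).precomp e.injective
  · simpa using this
  · refine Set.disjoint_left.2 fun x hx hx' => hij (e.symm.injective ?_)
    exact (Set.mem_singleton_iff.1 hx).symm.trans hx'

/-- The total mass is the sum of the cell masses, so `e^{-T}` splits over cells; grouping the
factors by cell exposes a product of independent variables. -/
lemma integral_exp_mul_prod (hG : IsCompletelyRandomMeasure (ρ.prod G₀) P G)
    (hρ : Integrable (fun r : ℝ≥0 => min 1 (r : ℝ)) ρ)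
    {ι : Type*} [Fintype ι] [DecidableEq ι] [MeasurableSpace ι]
    [MeasurableSingletonClass ι] {φ : Ω → ι} (hφ : Measurable φ) {n : ℕ} (c : Fin n → ι) :
    ∫ s, Real.exp (-(G s Set.univ).toReal) * ∏ i, (G s (φ ⁻¹' {c i})).toReal ∂P =
      Real.exp (G₀.real Set.univ * ∫ r, (Real.exp (-(r : ℝ)) - 1) ∂ρ) *
        ∏ b, bellPolynomial (tiltedMoment ρ) (G₀.real (φ ⁻¹' {b}))
          (Finset.univ.filter fun i => c i = b).card := by
  have hm : ∀ b, MeasurableSet (φ ⁻¹' {b}) := fun b => hφ (measurableSet_singleton b)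
  have h1 := (hG.iIndepFun_fiber hφ).integral_fun_prod_comp
    (f := fun b (x : ℝ≥0∞) => x.toReal ^ (Finset.univ.filter fun i => c i = b).card *
      Real.exp (-x.toReal)) (fun b => (hG.measurable_apply (hm b)).aemeasurable)
    (fun b => (Measurable.aestronglyMeasurable (by fun_prop)))
  simp only [hG.integral_pow_mul_exp hρ (hm _), Finset.prod_mul_distrib, ← Real.exp_sum,
    ← Finset.sum_mul] at h1
  have h2 : ∑ b, G₀.real (φ ⁻¹' {b}) = G₀.real Set.univ := by
    rw [measureReal_def, ← sum_measure_fiber hφ, ENNReal.toReal_sum fun b _ => by finiteness]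
    rfl
  rw [h2] at h1
  rw [mul_comm (Real.exp _), ← h1]
  refine integral_congr_ae ?_
  filter_upwards [hG.finite] with s hs
  have h3 : ∑ b, (G s (φ ⁻¹' {b})).toReal = (G s Set.univ).toReal := by
    rw [← sum_measure_fiber hφ (G s), ENNReal.toReal_sum fun b _ => ?_]
    exact ((measure_mono (Set.subset_univ _)).trans_lt hs).ne
  rw [Finset.sum_neg_distrib, h3, mul_comm]
  congr 1
  rw [← Finset.prod_fiberwise Finset.univ c]
  refine Finset.prod_congr rfl fun b _ => ?_
  rw [← Finset.prod_const]
  refine Finset.prod_congr rfl fun i hi => ?_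
  rw [(Finset.mem_filter.1 hi).2]

end IsCompletelyRandomMeasure

end CompletelyRandomMeasure

/-! ### Label vectors, their weights and cell masses -/

lemma prod_tsum_eq_tsum_prod {α : Type*} {n : ℕ} (f : Fin n → α → ℝ≥0∞) :
    ∏ i, ∑' k, f i k = ∑' c : Fin n → α, ∏ i, f i (c i) := by
  induction n with
  | zero => simp
  | succ n ih =>
    rw [Fin.prod_univ_succ, ih, ← (Fin.consEquiv fun _ : Fin (n + 1) => α).tsum_eq,
      ENNReal.tsum_prod', ← ENNReal.tsum_mul_right]
    refine tsum_congr fun k => ?_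
    rw [← ENNReal.tsum_mul_left]
    refine tsum_congr fun c => ?_
    simp [Fin.prod_univ_succ, Fin.consEquiv]

section Atoms

variable (r : ℕ → S → ℝ≥0) (loc : ℕ → S → Ω)

omit [MeasurableSpace S] in
lemma atomicMeasure_univ (s : S) : atomicMeasure r loc s Set.univ = ∑' k, (r k s : ℝ≥0∞) := by
  simp [atomicMeasure, Measure.sum_apply]

/-- The weight `e^{-T} ∏ᵢ r_{cᵢ}` of a label vector `c`, where `T` is the total mass. -/
noncomputable def labelWeight {n : ℕ} (c : Fin n → ℕ) (s : S) : ℝ≥0∞ :=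
  ENNReal.ofReal (Real.exp (-(totalMass r loc s : ℝ))) * ∏ i, (r (c i) s : ℝ≥0∞)

variable {r loc}

omit [MeasurableSpace S] in
lemma prod_atomicMeasure_fiber {ι : Type*} [DecidableEq ι] [MeasurableSpace ι]
    [MeasurableSingletonClass ι] {φ : Ω → ι} (hφ : Measurable φ) {n : ℕ} (a : Fin n → ι) (s : S) :
    ∏ i, atomicMeasure r loc s (φ ⁻¹' {a i}) =
      ∑' c : Fin n → ℕ, if (fun i => φ (loc (c i) s)) = a then ∏ i, (r (c i) s : ℝ≥0∞) else 0 := by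
  have h : ∀ b, atomicMeasure r loc s (φ ⁻¹' {b}) =
      ∑' k, if φ (loc k s) = b then (r k s : ℝ≥0∞) else 0 := fun b => by
    have hm : MeasurableSet (φ ⁻¹' {b}) := hφ (measurableSet_singleton b)
    rw [atomicMeasure, Measure.sum_apply _ hm]
    refine tsum_congr fun k => ?_
    rw [Measure.smul_apply, Measure.dirac_apply' _ hm]
    by_cases hk : φ (loc k s) = b
    · rw [Set.indicator_of_mem (by simpa using hk), if_pos hk, Pi.one_apply, smul_eq_mul, mul_one]
    · rw [Set.indicator_of_notMem (by simpa using hk), if_neg hk, smul_zero]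
  simp only [h]
  rw [prod_tsum_eq_tsum_prod]
  refine tsum_congr fun c => ?_
  split_ifs with hc
  · refine Finset.prod_congr rfl fun i _ => ?_
    rw [if_pos (congrFun hc i)]
  · obtain ⟨i, hi⟩ := Function.ne_iff.1 hc
    exact Finset.prod_eq_zero (Finset.mem_univ i) (if_neg hi)

-- Label vectors are grouped by the vector `a` of cells containing their atoms; for fixed `a` the
-- weights sum to a product of cell masses.
omit [MeasurableSpace S] in
open Classical in
lemma tsum_labelWeight_fiber {ι : Type*} [Fintype ι] [MeasurableSpace ι]
    [MeasurableSingletonClass ι] {φ : Ω → ι} (hφ : Measurable φ) {n : ℕ} (q : Fin n → ℕ) (s : S) :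
    (∑' c : Fin n → ℕ, if SamePattern (fun i => φ (loc (c i) s)) q then
        labelWeight r loc c s else 0) =
      ∑ a : Fin n → ι with SamePattern a q, ENNReal.ofReal (Real.exp (-(totalMass r loc s : ℝ))) *
        ∏ i, atomicMeasure r loc s (φ ⁻¹' {a i}) := by
  simp only [prod_atomicMeasure_fiber hφ, ← ENNReal.tsum_mul_left]
  rw [← Summable.tsum_finsetSum fun a _ => ENNReal.summable]
  refine tsum_congr fun c => ?_
  simp only [mul_ite, mul_zero, Finset.sum_ite_eq, Finset.mem_filter, Finset.mem_univ, true_and]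
  rfl

-- The sum equals `e^{-T} T ^ n`. The deterministic bound supplies domination in the passage to the
-- limit.
omit [MeasurableSpace S] in
lemma tsum_labelWeight_le (n : ℕ) {s : S} (hs : atomicMeasure r loc s Set.univ < ∞) :
    ∑' c : Fin n → ℕ, labelWeight r loc c s ≤ n.factorial := by
  simp only [labelWeight]
  rw [ENNReal.tsum_mul_left, ← prod_tsum_eq_tsum_prod fun _ k => (r k s : ℝ≥0∞),
    ← atomicMeasure_univ r loc s, Finset.prod_const, Finset.card_univ, Fintype.card_fin,
    ← ENNReal.coe_toNNReal hs.ne]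
  change ENNReal.ofReal _ * ((totalMass r loc s : ℝ≥0) : ℝ≥0∞) ^ n ≤ _
  rw [← ENNReal.ofReal_coe_nnreal, ← ENNReal.ofReal_pow (NNReal.coe_nonneg _),
    ← ENNReal.ofReal_mul (Real.exp_nonneg _), ← ENNReal.ofReal_natCast]
  refine ENNReal.ofReal_le_ofReal ?_
  rw [mul_comm]
  simpa using pow_mul_exp_neg_le n one_pos (totalMass r loc s).coe_nonneg

end Atoms

/-! ### From the conditional law to label weights, and the cell approximation -/

namespace IsCountMixture

variable {ρ : Measure ℝ≥0} {G₀ : Measure Ω} {P : Measure S} [IsProbabilityMeasure P]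
  {r : ℕ → S → ℝ≥0} {loc : ℕ → S → Ω} {m : S → ℕ} {z : ℕ → S → ℕ}

omit [IsProbabilityMeasure P] in
lemma measurable_totalMass (h : IsCountMixture ρ G₀ P r loc m z) :
    Measurable (totalMass r loc) :=
  ((Measure.measurable_coe MeasurableSet.univ).comp h.crm.measurable).ennreal_toNNReal

omit [IsProbabilityMeasure P] in
lemma measurable_labelWeight (h : IsCountMixture ρ G₀ P r loc m z) {n : ℕ} (c : Fin n → ℕ) :
    Measurable (labelWeight r loc c) := by
  have h1 := h.measurable_totalMass
  have h2 := h.measurable_weight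
  unfold labelWeight
  fun_prop

omit [IsProbabilityMeasure P] in
lemma measurableSet_labels (h : IsCountMixture ρ G₀ P r loc m z) (n : ℕ) (A : Set (Fin n → ℕ)) :
    MeasurableSet {s | m s = n ∧ (fun i : Fin n => z i s) ∈ A} := by
  have h1 : Measurable fun s => (fun i : Fin n => z i s) :=
    measurable_pi_lambda _ fun i => h.measurable_label i
  exact (h.measurable_size (measurableSet_singleton n)).inter (h1 (MeasurableSet.of_discrete (s := A)))

lemma measure_labels_eq (h : IsCountMixture ρ G₀ P r loc m z) (n : ℕ) (c : Fin (n + 1) → ℕ) :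
    P {s | m s = n + 1 ∧ ∀ i : Fin (n + 1), z i s = c i} =
      ENNReal.ofReal ((n + 1).factorial : ℝ)⁻¹ * ∫⁻ s, labelWeight r loc c s ∂P := by
  set E := {s | m s = n + 1 ∧ ∀ i : Fin (n + 1), z i s = c i}
  have hE : MeasurableSet E := by
    convert! h.measurableSet_labels (n + 1) {c} using 1
    ext s
    simp [E, funext_iff]
  have hm : atomSigma r loc ≤ ‹MeasurableSpace S› := by
    refine Measurable.comap_le (measurable_pi_lambda _ fun k => ?_)
    exact (h.measurable_weight k).prodMk (h.measurable_loc k)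
  have hlaw := h.condLaw (n + 1) c
  have hint := (integrable_condExp (μ := P) (m := atomSigma r loc)
    (f := E.indicator fun _ => (1 : ℝ))).congr hlaw
  have h1 : P.real E = ∫ s, (poissonMeasure (totalMass r loc s)).real {n + 1} *
        ∏ i, (r (c i) s : ℝ) / (totalMass r loc s : ℝ) ∂P := by
    rw [← integral_congr_ae hlaw, integral_condExp hm, integral_indicator_const _ hE]
    simp
  rw [← ofReal_measureReal, h1, ofReal_integral_eq_lintegral_ofReal hint
    (ae_of_all _ fun s => by positivity),
    ← lintegral_const_mul _ (h.measurable_labelWeight c)]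
  refine lintegral_congr_ae ?_
  filter_upwards [h.crm.finite] with s hs
  have h2 : ∀ k, r k s ≤ totalMass r loc s := fun k => by
    rw [← ENNReal.coe_le_coe, totalMass, ENNReal.coe_toNNReal hs.ne, atomicMeasure_univ]
    exact ENNReal.le_tsum k
  rw [labelWeight, poissonMeasure_real_singleton]
  simp only [← ENNReal.ofReal_coe_nnreal]
  rw [← ENNReal.ofReal_prod_of_nonneg fun i _ => NNReal.coe_nonneg _,
    ← ENNReal.ofReal_mul (Real.exp_nonneg _), ← ENNReal.ofReal_mul (by positivity)]
  congr 1
  -- At zero total mass the quotients are `0 / 0 = 0`. Both products vanish because the sample has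
  -- at least one point, hence the index `n + 1`.
  rcases eq_or_ne (totalMass r loc s) 0 with h0 | h0
  · have h3 : r (c 0) s = 0 := le_antisymm ((h2 _).trans h0.le) (zero_le)
    rw [Fin.prod_univ_succ, Fin.prod_univ_succ, h3]
    simp
  · have h0' : (totalMass r loc s : ℝ) ≠ 0 := by exact_mod_cast h0
    rw [Finset.prod_div_distrib, Finset.prod_const, Finset.card_univ, Fintype.card_fin]
    field_simp

open Classical in
lemma measure_samePattern_eq_lintegral (h : IsCountMixture ρ G₀ P r loc m z) (n : ℕ)
    (q : Fin (n + 1) → ℕ) :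
    P {s | m s = n + 1 ∧ SamePattern (fun i : Fin (n + 1) => z i s) q} =
      ENNReal.ofReal ((n + 1).factorial : ℝ)⁻¹ *
        ∫⁻ s, ∑' c : Fin (n + 1) → ℕ, (if SamePattern c q then labelWeight r loc c s else 0) ∂P := by
  have h1 : {s | m s = n + 1 ∧ SamePattern (fun i : Fin (n + 1) => z i s) q} =
      ⋃ c : Fin (n + 1) → ℕ, {s | m s = n + 1 ∧ (fun i : Fin (n + 1) => z i s) ∈
        {c' | c' = c ∧ SamePattern c q}} := by
    ext s
    simp
  rw [h1, measure_iUnion, lintegral_tsum, ← ENNReal.tsum_mul_left]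
  · refine tsum_congr fun c => ?_
    by_cases hc : SamePattern c q
    · simp only [hc, and_true, if_true]
      rw [← h.measure_labels_eq]
      simp [funext_iff]
    · simp [hc]
  · intro c
    split_ifs
    exacts [(h.measurable_labelWeight c).aemeasurable, aemeasurable_const]
  · intro c c' hcc'
    refine Set.disjoint_left.2 fun s hs hs' => hcc' ?_
    exact hs.2.1.symm.trans hs'.2.1
  · exact fun c => h.measurableSet_labels _ _

-- Dominated convergence is used twice, over the probability space and over label vectors with
-- counting measure. Atoms are distinct only where weights are positive, but vectors using a zero
-- weight contribute nothing.
open Classical in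
lemma tendsto_lintegral_cell (h : IsCountMixture ρ G₀ P r loc m z)
    {f : Ω → ℕ → Bool} (hf : Measurable f) (hinj : Function.Injective f) {n : ℕ} (q : Fin n → ℕ) :
    Tendsto (fun N => ∫⁻ s, ∑' c : Fin n → ℕ,
        (if SamePattern (fun i => cell f N (loc (c i) s)) q then labelWeight r loc c s else 0) ∂P)
      atTop (𝓝 (∫⁻ s, ∑' c : Fin n → ℕ,
        (if SamePattern c q then labelWeight r loc c s else 0) ∂P)) := by
  have hle : ∀ (p : (Fin n → ℕ) → Prop) s, (∑' c : Fin n → ℕ,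
      if p c then labelWeight r loc c s else 0) ≤ ∑' c : Fin n → ℕ, labelWeight r loc c s :=
    fun p s => ENNReal.tsum_le_tsum fun c => by split_ifs <;> simp
  refine tendsto_lintegral_of_dominated_convergence
    (fun s => ∑' c : Fin n → ℕ, labelWeight r loc c s) (fun N => ?_)
    (fun N => ae_of_all _ fun s => hle _ s) ?_ ?_
  · refine Measurable.tsum fun c => Measurable.ite ?_ (h.measurable_labelWeight c) measurable_const
    have h1 : Measurable fun s => (fun i => cell f N (loc (c i) s)) :=
      measurable_pi_lambda _ fun i => (measurable_cell hf N).comp (h.measurable_loc _)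
    exact h1 (MeasurableSet.of_discrete (s := {a | SamePattern a q}))
  · refine ne_top_of_le_ne_top (b := (n.factorial : ℝ≥0∞)) (by simp) ?_
    calc ∫⁻ s, ∑' c : Fin n → ℕ, labelWeight r loc c s ∂P
        ≤ ∫⁻ _, (n.factorial : ℝ≥0∞) ∂P := lintegral_mono_ae (by
          filter_upwards [h.crm.finite] with s hs using tsum_labelWeight_le n hs)
      _ = n.factorial := by simp
  · filter_upwards [h.crm.finite, h.distinct] with s hs hd
    simp only [← lintegral_count]
    refine tendsto_lintegral_of_dominated_convergence (fun c => labelWeight r loc c s)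
      (fun N => Measurable.of_discrete)
      (fun N => ae_of_all _ fun c => by dsimp only; split_ifs <;> simp) ?_ (ae_of_all _ fun c => ?_)
    · rw [lintegral_count]
      exact ne_top_of_le_ne_top (by simp) (tsum_labelWeight_le n hs)
    · by_cases hc : ∀ i, 0 < r (c i) s
      · have h1 : ∀ᶠ N in atTop, ∀ i j, cell f N (loc (c i) s) = cell f N (loc (c j) s) ↔
            loc (c i) s = loc (c j) s :=
          eventually_all.2 fun i => eventually_all.2 fun j => eventually_cell_eq_iff hinj _ _
        refine tendsto_const_nhds.congr' ?_
        filter_upwards [h1] with N hN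
        have h2 : SamePattern c fun i => cell f N (loc (c i) s) := fun i j =>
          (⟨fun hij => by rw [hij], fun hij => hd _ _ (hc i) (hc j) hij⟩ :
            c i = c j ↔ loc (c i) s = loc (c j) s).trans (hN i j).symm
        exact if_congr ⟨h2.symm.trans, h2.trans⟩ rfl rfl
      · obtain ⟨i, hi⟩ := not_forall.1 hc
        have : labelWeight r loc c s = 0 := by
          rw [labelWeight, Finset.prod_eq_zero (Finset.mem_univ i), mul_zero]
          simpa using hi
        simp [this]

end IsCountMixture

/-! ### Passing to the limit over cells -/

section Pattern

-- An assignment of points to cells with pattern `q` is an injective assignment of clusters to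
-- cells; unoccupied cells contribute `F b 0 = 1`.
open Classical in
lemma sum_samePattern_eq_sum_injective {ι : Type*} [Fintype ι] [DecidableEq ι] {n : ℕ}
    (q : Fin n → ℕ) (F : ι → ℕ → ℝ) (hF : ∀ b, F b 0 = 1) :
    ∑ a : Fin n → ι with SamePattern a q,
        ∏ b, F b (Finset.univ.filter fun i => a i = b).card =
      ∑ a : ↥(Finset.univ.image q) → ι with Function.Injective a,
        ∏ v, F (a v) (clusterSize q v) := by
  set V := Finset.univ.image q
  let q' : Fin n → V := fun i => ⟨q i, Finset.mem_image_of_mem q (Finset.mem_univ i)⟩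
  have hq' : Function.Surjective q' := by
    rintro ⟨v, hv⟩
    obtain ⟨i, -, rfl⟩ := Finset.mem_image.1 hv
    exact ⟨i, rfl⟩
  have hq'' : ∀ i j, q' i = q' j ↔ q i = q j := fun i j => Subtype.ext_iff
  symm
  refine Finset.sum_bij (fun a _ => a ∘ q') ?_ ?_ ?_ ?_
  · intro a ha
    have ha := (Finset.mem_filter.1 ha).2
    refine Finset.mem_filter.2 ⟨Finset.mem_univ _, fun i j => ?_⟩
    rw [← hq'']
    exact ha.eq_iff
  · intro a _ a' _ h
    exact hq'.injective_comp_right h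
  · intro a ha
    have ha := (Finset.mem_filter.1 ha).2
    choose g hg using hq'
    have hag : (a ∘ g) ∘ q' = a := by
      funext i
      exact (ha _ _).2 ((hq'' _ _).1 (hg _))
    refine ⟨a ∘ g, Finset.mem_filter.2 ⟨Finset.mem_univ _, fun v w h => ?_⟩, hag⟩
    rw [← hg v, ← hg w]
    exact (hq'' _ _).2 ((ha _ _).1 h)
  · intro a ha
    have ha := (Finset.mem_filter.1 ha).2
    rw [← Finset.prod_subset (Finset.subset_univ (Finset.univ.image a)),
      Finset.prod_image fun v _ w _ h => ha h]
    · refine Finset.prod_congr rfl fun v _ => ?_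
      congr 1
      unfold clusterSize
      congr 1
      ext i
      simp [ha.eq_iff, q', Subtype.ext_iff]
    · intro b _ hb
      have : (Finset.univ.filter fun i => (a ∘ q') i = b) = ∅ := by
        refine Finset.filter_eq_empty_iff.2 fun i _ hi => hb ?_
        exact Finset.mem_image.2 ⟨q' i, Finset.mem_univ _, hi⟩
      rw [this, Finset.card_empty, hF]

end Pattern

section Limit

variable {ρ : Measure ℝ≥0} {G₀ : Measure Ω} [IsFiniteMeasure G₀]

lemma clusterSize_pos {n : ℕ} (q : Fin n → ℕ) {v : ℕ} (hv : v ∈ Finset.univ.image q) :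
    0 < clusterSize q v := by
  obtain ⟨i, -, hi⟩ := Finset.mem_image.1 hv
  exact Finset.card_pos.2 ⟨i, by simpa using hi⟩

open Classical in
lemma tendsto_sum_bellPolynomial_cell [NullSingletonClass G₀] {f : Ω → ℕ → Bool}
    (hf : Measurable f) (hinj : Function.Injective f) (κ : ℕ → ℝ) {n : ℕ} (q : Fin n → ℕ) :
    Tendsto (fun N => ∑ a : Fin n → (Fin N → Bool) with SamePattern a q,
        ∏ b, bellPolynomial κ (G₀.real (cell f N ⁻¹' {b}))
          (Finset.univ.filter fun i => a i = b).card) atTop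
      (𝓝 (∏ v ∈ Finset.univ.image q, G₀.real Set.univ * κ (clusterSize q v))) := by
  have hsum : ∀ N, ∑ b, G₀.real (cell f N ⁻¹' {b}) = G₀.real Set.univ := fun N => by
    rw [measureReal_def, ← sum_measure_fiber (measurable_cell hf N),
      ENNReal.toReal_sum fun b _ => by finiteness]
    rfl
  choose K hK using exists_abs_bellPolynomial_succ_sub_le κ (G₀.real Set.univ)
  rw [← Finset.prod_coe_sort]
  refine (tendsto_sum_injective_prod (V := ↥(Finset.univ.image q))
    (g := fun N b => G₀.real (cell f N ⁻¹' {b}))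
    (x := fun N v b => bellPolynomial κ (G₀.real (cell f N ⁻¹' {b})) (clusterSize q v))
    (κ := fun v => κ (clusterSize q v))
    (K := ∑ v : ↥(Finset.univ.image q), |K (clusterSize q v - 1)|)
    (fun N b => measureReal_nonneg) hsum (tendsto_sum_sq_cell hf hinj G₀) ?_).congr ?_
  · intro N v b
    obtain ⟨k, hk⟩ := Nat.exists_eq_succ_of_ne_zero (clusterSize_pos q v.2).ne'
    have h1 := hK k _ (measureReal_nonneg (μ := G₀) (s := cell f N ⁻¹' {b}))
      (measureReal_mono (Set.subset_univ _))
    have h2 : |K k| ≤ ∑ v : ↥(Finset.univ.image q), |K (clusterSize q v - 1)| := by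
      have := Finset.single_le_sum (f := fun v : ↥(Finset.univ.image q) =>
        |K (clusterSize q v - 1)|) (fun v _ => abs_nonneg _) (Finset.mem_univ v)
      simpa [hk] using this
    rw [hk]
    exact h1.trans (mul_le_mul_of_nonneg_right ((le_abs_self _).trans h2) (sq_nonneg _))
  · intro N
    exact (sum_samePattern_eq_sum_injective q (fun b k => bellPolynomial κ
      (G₀.real (cell f N ⁻¹' {b})) k) fun b => bellPolynomial_zero _ _).symm

lemma IsCompletelyRandomMeasure.lintegral_exp_mul_prod {P : Measure S} [IsProbabilityMeasure P]
    {G : S → Measure Ω} (hG : IsCompletelyRandomMeasure (ρ.prod G₀) P G)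
    (hρ : Integrable (fun r : ℝ≥0 => min 1 (r : ℝ)) ρ)
    {ι : Type*} [Fintype ι] [DecidableEq ι] [MeasurableSpace ι]
    [MeasurableSingletonClass ι] {φ : Ω → ι} (hφ : Measurable φ) {n : ℕ} (c : Fin n → ι) :
    ∫⁻ s, ENNReal.ofReal (Real.exp (-(G s Set.univ).toReal)) * ∏ i, G s (φ ⁻¹' {c i}) ∂P =
      ENNReal.ofReal (Real.exp (G₀.real Set.univ * ∫ r, (Real.exp (-(r : ℝ)) - 1) ∂ρ) *
        ∏ b, bellPolynomial (tiltedMoment ρ) (G₀.real (φ ⁻¹' {b}))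
          (Finset.univ.filter fun i => c i = b).card) := by
  have hm : ∀ b, Measurable fun s => G s (φ ⁻¹' {b}) := fun b =>
    hG.measurable_apply (hφ (measurableSet_singleton b))
  have hu : Measurable fun s => G s Set.univ := hG.measurable_apply MeasurableSet.univ
  rw [← hG.integral_exp_mul_prod hρ hφ, ofReal_integral_eq_lintegral_ofReal]
  · refine lintegral_congr_ae ?_
    filter_upwards [hG.finite] with s hs
    rw [ENNReal.ofReal_mul (Real.exp_nonneg _),
      ENNReal.ofReal_prod_of_nonneg fun i _ => ENNReal.toReal_nonneg]
    congr 1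
    refine Finset.prod_congr rfl fun i _ => (ENNReal.ofReal_toReal ?_).symm
    exact ((measure_mono (Set.subset_univ _)).trans_lt hs).ne
  · refine (integrable_const (n.factorial : ℝ)).mono' (by fun_prop) ?_
    filter_upwards [hG.finite] with s hs
    rw [Real.norm_of_nonneg (by positivity)]
    calc Real.exp (-(G s Set.univ).toReal) * ∏ i, (G s (φ ⁻¹' {c i})).toReal
        ≤ Real.exp (-(G s Set.univ).toReal) * ∏ _i : Fin n, (G s Set.univ).toReal := by
          gcongr with i _
          · exact hs.ne
          · exact Set.subset_univ _
      _ ≤ n.factorial := by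
          rw [Finset.prod_const, Finset.card_univ, Fintype.card_fin, mul_comm]
          simpa using pow_mul_exp_neg_le n one_pos
            (ENNReal.toReal_nonneg (a := G s Set.univ))
  · exact ae_of_all _ fun s => by positivity

end Limit

/-! ### The cluster probability function -/

namespace IsCountMixture

variable {ρ : Measure ℝ≥0} {G₀ : Measure Ω} [IsFiniteMeasure G₀] [NullSingletonClass G₀]
  [MeasurableSpace.CountablySeparated Ω]
  {P : Measure S} [IsProbabilityMeasure P]
  {r : ℕ → S → ℝ≥0} {loc : ℕ → S → Ω} {m : S → ℕ} {z : ℕ → S → ℕ}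

/-- The exchangeable cluster probability function of the count-mixture model. -/
lemma measure_samePattern (h : IsCountMixture ρ G₀ P r loc m z)
    (hρ : Integrable (fun r : ℝ≥0 => min 1 (r : ℝ)) ρ) (n : ℕ) (q : Fin (n + 1) → ℕ) :
    P {s | m s = n + 1 ∧ SamePattern (fun i : Fin (n + 1) => z i s) q} =
      ENNReal.ofReal (((n + 1).factorial : ℝ)⁻¹ *
        (Real.exp (G₀.real Set.univ * ∫ r, (Real.exp (-(r : ℝ)) - 1) ∂ρ) *
          ∏ v ∈ Finset.univ.image q, G₀.real Set.univ * tiltedMoment ρ (clusterSize q v))) := by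
  classical
  obtain ⟨f, hf, hinj⟩ :=
    MeasurableSpace.measurable_injection_nat_bool_of_countablySeparated Ω
  set C := Real.exp (G₀.real Set.univ * ∫ r, (Real.exp (-(r : ℝ)) - 1) ∂ρ)
  rw [h.measure_samePattern_eq_lintegral, ENNReal.ofReal_mul (by positivity)]
  congr 1
  -- Both quantities are limits of the same cell sums: one through the random atoms, the other
  -- through Bell polynomials.
  refine tendsto_nhds_unique (h.tendsto_lintegral_cell hf hinj q) ?_
  have h1 := (ENNReal.continuous_ofReal.tendsto _).comp
    ((tendsto_sum_bellPolynomial_cell (G₀ := G₀) hf hinj (tiltedMoment ρ) q).const_mul C)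
  refine h1.congr fun N => ?_
  -- Nonnegativity is read off from the expectation these products represent, so signs of Bell
  -- polynomials need not be examined.
  have hnn : ∀ a : Fin (n + 1) → (Fin N → Bool), 0 ≤ C * ∏ b, bellPolynomial (tiltedMoment ρ)
      (G₀.real (cell f N ⁻¹' {b})) (Finset.univ.filter fun i => a i = b).card := fun a => by
    rw [← h.crm.integral_exp_mul_prod hρ (measurable_cell hf N)]
    exact integral_nonneg fun s => by positivity
  simp only [Function.comp_apply, tsum_labelWeight_fiber (measurable_cell hf N)]
  rw [lintegral_finsetSum, Finset.mul_sum, ENNReal.ofReal_sum_of_nonneg fun a _ => hnn a]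
  · exact Finset.sum_congr rfl fun a _ =>
      (h.crm.lintegral_exp_mul_prod hρ (measurable_cell hf N) a).symm
  · intro a _
    have h2 := h.measurable_totalMass
    have h3 := fun i => h.crm.measurable_apply (measurable_cell hf N (measurableSet_singleton (a i)))
    fun_prop

lemma exists_measure_samePattern_eq (h : IsCountMixture ρ G₀ P r loc m z) (n : ℕ) :
    ∃ C : ℝ, 0 < C ∧ ∀ q : Fin (n + 1) → ℕ,
      P {s | m s = n + 1 ∧ SamePattern (fun i : Fin (n + 1) => z i s) q} =
        ENNReal.ofReal (C *
          ∏ v ∈ Finset.univ.image q, G₀.real Set.univ * tiltedMoment ρ (clusterSize q v)) := by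
  rcases eq_or_ne G₀ 0 with h0 | h0
  -- With `G₀ = 0` the product Lévy measure is zero whatever `ρ` is, so `ρ` may be replaced by `0`,
  -- which is trivially integrable.
  · have h' : IsCountMixture 0 G₀ P r loc m z := by
      refine ⟨h.measurable_weight, h.measurable_loc, h.measurable_size, h.measurable_label,
        h.distinct, ?_, h.condLaw⟩
      have := h.crm
      subst h0
      simpa using this
    refine ⟨1, one_pos, fun q => ?_⟩
    rw [h'.measure_samePattern (by simp)]
    have hz : ∀ κ : ℕ → ℝ, ∏ v ∈ Finset.univ.image q, G₀.real Set.univ * κ (clusterSize q v) = 0 :=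
      fun κ => Finset.prod_eq_zero (Finset.mem_image_of_mem q (Finset.mem_univ 0)) (by simp [h0])
    simp [hz]
  · refine ⟨((n + 1).factorial : ℝ)⁻¹ *
      Real.exp (G₀.real Set.univ * ∫ r, (Real.exp (-(r : ℝ)) - 1) ∂ρ), by positivity, fun q => ?_⟩
    rw [h.measure_samePattern (integrable_min_one_of_lintegral_prod h0 h.crm.levy), ← mul_assoc]

end IsCountMixture

/-! ### Positivity of moments and the prediction rule -/

section Positivity

variable {ρ : Measure ℝ≥0}

lemma tiltedMoment_nonneg (n : ℕ) : 0 ≤ tiltedMoment ρ n :=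
  integral_nonneg fun r => by positivity

/-- Each moment of order at least one is positive exactly when `ρ` charges the positive reals, a
condition independent of the order. -/
lemma tiltedMoment_succ_pos_of_pos (hρ : Integrable (fun r : ℝ≥0 => min 1 (r : ℝ)) ρ) {j : ℕ}
    (hj : 0 < j) (h : 0 < tiltedMoment ρ j) (n : ℕ) : 0 < tiltedMoment ρ (n + 1) := by
  have key : ∀ k, 0 < tiltedMoment ρ (k + 1) ↔ 0 < ρ {r | r ≠ 0} := by
    intro k
    have hi : Integrable (fun r : ℝ≥0 => (r : ℝ) ^ (k + 1) * Real.exp (-(r : ℝ))) ρ := by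
      simpa using integrable_pow_mul_exp hρ k one_pos
    rw [tiltedMoment, integral_pos_iff_support_of_nonneg (fun r => by positivity) hi]
    have : Function.support (fun r : ℝ≥0 => (r : ℝ) ^ (k + 1) * Real.exp (-(r : ℝ))) =
        {r | r ≠ 0} := by
      ext r
      simp [Real.exp_ne_zero]
    rw [this]
  obtain ⟨k, rfl⟩ := Nat.exists_eq_succ_of_ne_zero hj.ne'
  exact (key n).2 ((key k).1 h)

end Positivity

/-- The product of cluster factors after adding one element to cluster `k` is the product before,
times the prediction weight of `k`. -/
lemma prod_insertNth_eq_mul_predictionWeight {ρ : Measure ℝ≥0} {γ : ℝ}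
    (hpos : ∀ n, 0 < tiltedMoment ρ (n + 1)) {n : ℕ} (i : Fin (n + 1)) {y : Fin n → ℕ}
    (hy : Finset.univ.image y = Finset.Icc 1 (numClusters y)) {k : ℕ}
    (hk : k ∈ Finset.Icc 1 (numClusters y + 1)) :
    ∏ v ∈ Finset.univ.image (i.insertNth (α := fun _ => ℕ) k y),
        γ * tiltedMoment ρ (clusterSize (i.insertNth (α := fun _ => ℕ) k y) v) =
      (∏ v ∈ Finset.univ.image y, γ * tiltedMoment ρ (clusterSize y v)) *
        predictionWeight γ ρ y k := by
  simp only [image_insertNth, clusterSize_insertNth]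
  rw [Finset.mem_Icc] at hk
  have hne : ∀ s : Finset ℕ, k ∉ s →
      ∏ v ∈ s, γ * tiltedMoment ρ (clusterSize y v + if k = v then 1 else 0) =
        ∏ v ∈ s, γ * tiltedMoment ρ (clusterSize y v) := fun s hs =>
    Finset.prod_congr rfl fun v hv => by rw [if_neg (fun hkv : k = v => hs (hkv ▸ hv)), add_zero]
  -- For an existing cluster one factor changes, its size growing by one; a new cluster has size `0
  -- + 1` and adds a factor.
  by_cases hkl : k ≤ numClusters y
  · have hmem : k ∈ Finset.univ.image y := by rw [hy, Finset.mem_Icc]; exact ⟨hk.1, hkl⟩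
    rw [Finset.insert_eq_of_mem hmem, ← Finset.mul_prod_erase _ _ hmem,
      ← Finset.mul_prod_erase _ _ hmem, hne _ (Finset.notMem_erase _ _), predictionWeight,
      if_pos hkl, if_pos rfl]
    obtain ⟨j, hj⟩ := Nat.exists_eq_succ_of_ne_zero (clusterSize_pos y hmem).ne'
    have h1 : tiltedMoment ρ (clusterSize y k) ≠ 0 := by rw [hj]; exact (hpos j).ne'
    field_simp
  · have hmem : k ∉ Finset.univ.image y := by
      rw [hy, Finset.mem_Icc]
      exact fun h => hkl h.2
    have h0 : clusterSize y k = 0 := by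
      refine Finset.card_eq_zero.2 (Finset.filter_eq_empty_iff.2 fun j _ hj => hmem ?_)
      exact Finset.mem_image.2 ⟨j, Finset.mem_univ j, hj⟩
    rw [Finset.prod_insert hmem, hne _ hmem, predictionWeight, if_neg hkl, if_pos rfl, h0,
      zero_add, mul_comm]

end CountMixture

open CountMixture in
theorem mainTheorem4 {S Ω : Type*} [MeasurableSpace S] [MeasurableSpace Ω]
    [MeasurableSpace.CountablySeparated Ω]
    (P : Measure S) [IsProbabilityMeasure P]
    (ρ : Measure ℝ≥0) (G₀ : Measure Ω) [IsFiniteMeasure G₀] [NullSingletonClass G₀]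
    (r : ℕ → S → ℝ≥0) (loc : ℕ → S → Ω) (m : S → ℕ) (z : ℕ → S → ℕ)
    (h : CountMixture.IsCountMixture ρ G₀ P r loc m z)
    (n : ℕ) (i : Fin (n + 1)) (y : Fin n → ℕ)
    (hy : P {s | CountMixture.labelsWithout i (fun j => z j s) = y ∧ m s = n + 1} ≠ 0) :
    (∀ k ∈ Finset.Icc 1 (CountMixture.numClusters y + 1),
      0 < CountMixture.predictionWeight (G₀.real Set.univ) ρ y k) ∧
    ∀ k ∈ Finset.Icc 1 (CountMixture.numClusters y + 1),
      (P[{s | CountMixture.labelOf i (fun j => z j s) = k} |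
          {s | CountMixture.labelsWithout i (fun j => z j s) = y ∧ m s = n + 1}]).toReal =
        CountMixture.predictionWeight (G₀.real Set.univ) ρ y k /
          ∑ k' ∈ Finset.Icc 1 (CountMixture.numClusters y + 1),
            CountMixture.predictionWeight (G₀.real Set.univ) ρ y k' := by
  set γ := G₀.real Set.univ with hγ
  set B := {s | labelsWithout i (fun j => z j s) = y ∧ m s = n + 1} with hB
  set I := Finset.Icc 1 (numClusters y + 1) with hI
  obtain ⟨C, hC, hCq⟩ := h.exists_measure_samePattern_eq n
  obtain ⟨s₀, hs₀⟩ := nonempty_of_measure_ne_zero hy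
  set q : ℕ → Fin (n + 1) → ℕ := fun k => i.insertNth (α := fun _ => ℕ) k y
  have himage : Finset.univ.image y = Finset.Icc 1 (numClusters y) := by
    rw [← hs₀.1, labelsWithout, numClusters_appearanceLabel, image_appearanceLabel]
  have hinter : ∀ k ∈ I, B ∩ {s | labelOf i (fun j => z j s) = k} =
      {s | m s = n + 1 ∧ SamePattern (fun j : Fin (n + 1) => z j s) (q k)} := by
    intro k hk
    ext s
    have := labels_eq_iff_samePattern (c := fun j : Fin (n + 1) => z j s) hs₀.1 hk
    simp only [hB, Set.mem_inter_iff, Set.mem_ofPred_eq, q, ← this]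
    tauto
  have hBmeas : MeasurableSet B := by
    convert! h.measurableSet_labels (n + 1) {c | labelsWithout i c = y} using 1
    ext s
    simp [hB, and_comm]
  have hp : ∀ k ∈ I, P (B ∩ {s | labelOf i (fun j => z j s) = k}) =
      ENNReal.ofReal (C * ∏ v ∈ Finset.univ.image (q k), γ * tiltedMoment ρ (clusterSize (q k) v)) :=
    fun k hk => by rw [hinter k hk, hCq]
  have hPB : P B = ∑ k ∈ I, P (B ∩ {s | labelOf i (fun j => z j s) = k}) := by
    have hU : B = ⋃ k ∈ I, B ∩ {s | labelOf i (fun j => z j s) = k} := by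
      ext s
      simp only [Set.mem_iUnion, Set.mem_inter_iff, Set.mem_ofPred_eq, exists_prop]
      exact ⟨fun hs => ⟨_, labelOf_mem_Icc hs.1, hs, rfl⟩, fun ⟨_, _, hs, _⟩ => hs⟩
    conv_lhs => rw [hU]
    refine measure_biUnion_finset ?_ fun k hk => ?_
    · intro k _ k' _ hkk'
      refine Set.disjoint_left.2 fun s hs hs' => hkk' (hs.2.symm.trans hs'.2)
    · rw [hinter k hk]
      exact h.measurableSet_labels (n + 1) {c | SamePattern c (q k)}
  -- Positive probability of `y` forces some extension `k₀` to have positive probability. A nonzero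
  -- factor of its product then yields `γ > 0` and one positive moment, hence all of them.
  obtain ⟨k₀, hk₀, hk₀'⟩ := Finset.exists_ne_zero_of_sum_ne_zero (hPB ▸ hy)
  have hprod₀ : ∏ v ∈ Finset.univ.image (q k₀), γ * tiltedMoment ρ (clusterSize (q k₀) v) ≠ 0 := by
    intro h0
    rw [hp k₀ hk₀, h0, mul_zero, ENNReal.ofReal_zero] at hk₀'
    exact hk₀' rfl
  have hfac₀ := Finset.prod_ne_zero_iff.1 hprod₀ (q k₀ 0)
    (Finset.mem_image_of_mem _ (Finset.mem_univ 0))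
  have hγpos : 0 < γ := measureReal_nonneg.lt_of_ne' (left_ne_zero_of_mul hfac₀)
  have hG₀ : G₀ ≠ 0 := by
    rintro rfl
    simp [hγ] at hγpos
  have hκ : ∀ k, 0 < tiltedMoment ρ (k + 1) :=
    tiltedMoment_succ_pos_of_pos (integrable_min_one_of_lintegral_prod hG₀ h.crm.levy)
      (clusterSize_pos (q k₀) (Finset.mem_image_of_mem _ (Finset.mem_univ 0)))
      ((tiltedMoment_nonneg _).lt_of_ne' (right_ne_zero_of_mul hfac₀))
  have hκ' : ∀ v ∈ Finset.univ.image y, 0 < tiltedMoment ρ (clusterSize y v) := by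
    intro v hv
    obtain ⟨j, hj⟩ := Nat.exists_eq_succ_of_ne_zero (clusterSize_pos y hv).ne'
    rw [hj]
    exact hκ j
  have hw : ∀ k ∈ I, 0 < predictionWeight γ ρ y k := by
    intro k hk
    rw [hI, Finset.mem_Icc] at hk
    unfold predictionWeight
    split_ifs with hkl
    · exact div_pos (hκ _) (hκ' k (by rw [himage, Finset.mem_Icc]; exact ⟨hk.1, hkl⟩))
    · exact mul_pos hγpos (hκ 0)
  refine ⟨hw, fun k hk => ?_⟩
  -- The part of the probability shared by all `k`; it cancels in the conditional probability.
  set D := C * ∏ v ∈ Finset.univ.image y, γ * tiltedMoment ρ (clusterSize y v) with hD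
  have hDpos : 0 < D := mul_pos hC (Finset.prod_pos fun v hv => mul_pos hγpos (hκ' v hv))
  have hpr : ∀ k ∈ I, (P (B ∩ {s | labelOf i (fun j => z j s) = k})).toReal =
      D * predictionWeight γ ρ y k := by
    intro k hk
    rw [hp k hk, prod_insertNth_eq_mul_predictionWeight hκ i himage hk, ← mul_assoc, ← hD,
      ENNReal.toReal_ofReal (mul_pos hDpos (hw k hk)).le]
  rw [cond_apply hBmeas, ENNReal.toReal_mul, ENNReal.toReal_inv, hpr k hk, hPB,
    ENNReal.toReal_sum fun k _ => measure_ne_top _ _, Finset.sum_congr rfl hpr, ← Finset.mul_sum,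
    inv_mul_eq_div, mul_div_mul_left _ _ hDpos.ne']
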